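/- Let $(C(x))_{x\in\mathbb Z}$ be unitary $2\times2$ matrices with entries $c_{jk}(x)$ such that $c_{11}(x)\neq0\neq c_{22}(x)$ for all $x$ and $C(x)=I_2$ for all but finitely many $x$. For $\psi=(\psi^L,\psi^R):\mathbb Z\to\mathbb C^2$ put $(C\psi)(x)=C(x)\psi(x)$, $(S_0\psi)(x)=(\psi^L(x+1),\psi^R(x-1))$ and $U=S_0C$; $U$ is unitary on $\mathcal H=\ell^2(\mathbb Z;\mathbb C^2)$. Let $\operatorname{chs}=[x^-,x^+]\subset\mathbb R$ be the convex hull of $\{x: C(x)\neq I_2\}$. **Resonances.** For a bounded interval $J\supset\operatorname{chs}$, the family $\mathbb 1_J(U-\lambda)^{-1}\mathbb 1_J$, $|\lambda|>1$, of bounded operators on $\mathcal H$ extends to a meromorphic family $R_J(\lambda)$, $\lambda\in\mathbb C$. The non-zero resonances of $U$ are the poles $\lambda\ne0$ of $R_J$, and $m(\lambda)=\operatorname{rank}\oint_\lambda R_J(\mu)\,d\mu$ (integral over a small circle around $\lambda$) is the multiplicity of $\lambda$. **Transfer matrix.** For $\lambda\neq0$ let $$T_\lambda(x)=\frac1{c_{11}(x)}\begin{pmatrix}\lambda&-c_{12}(x)\\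 c_{21}(x)&\lambda^{-1}\det C(x)\end{pmatrix},\qquad \mathbb T(\lambda)=T_\lambda(x^+)T_\lambda(x^+-1)\cdots T_\lambda(x^-),\qquad \varDelta=\det\mathbb T(\lambda);$$ $\varDelta$ does not depend on $\lambda$ (and $\varDelta=1$ if $C(x)=I_2$ for all $x$). **Scattering matrix.** Let $\Psi_L(\lambda,x)=(\lambda^x,0)$, $\Psi_R(\lambda,x)=(0,\lambda^{-x})$, and let the Jost solutions $\tilde\Psi_L^\pm$, $\tilde\Psi_R^\pm$ be the solutions of $(U-\lambda)\psi=0$ on $\mathbb Z$ that coincide with $\Psi_L$, $\Psi_R$, respectively, for all $x$ sufficiently close to $\pm\infty$. For $|\lambda|=1$ the pair $(\tilde\Psi_L^-,\tilde\Psi_R^+)$ is linearly independent and the scattering matrix $S(\lambda)$ is defined by $(\tilde\Psi_L^-,\tilde\Psi_R^+)\,S(\lambda)=(\tilde\Psi_L^+,\tilde\Psi_R^-)$. It extends meromorphically to $\lambda\in\mathbb C$; the extension is again denoted $S(\lambda)$. **Claim.** Suppose that $\varDelta\neq-1$; this holds for example if $c_{11}(x)=c_{22}(x)$ for all $x\in\mathbb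 Z$. Then, for every bounded interval $J\supset\operatorname{chs}$, the non-zero resonances are exactly the poles of $\operatorname{tr}S(\lambda)$ in $\mathbb C$, and the order of the pole of $\operatorname{tr}S$ at a non-zero resonance $\lambda$ is $m(\lambda)$. Moreover, for every non-zero resonance $\lambda$, $$m(\lambda)=-\frac1{2\pi i}\oint_\lambda\operatorname{tr}\bigl((\partial_\mu S(\mu))S(\mu)^{-1}\bigr)\,d\mu,$$ the integral being taken counterclockwise over any sufficiently small circle around $\lambda$. -/

import Mathlib

open Filter Topology

namespace QuantumWalk

noncomputable section

/-- The internal space `ℂ²`; the coordinate `0` is the left-moving entry `ψ^L` and the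
coordinate `1` is the right-moving entry `ψ^R`. -/
abbrev Spin : Type := EuclideanSpace ℂ (Fin 2)

/-- The Hilbert space `ℓ²(ℤ; ℂ²)`. -/
abbrev Hilb : Type := lp (fun _ : ℤ => Spin) 2

/-- A sequence of unitary `2 × 2` matrices. -/
abbrev Coin : Type := ℤ → Matrix.unitaryGroup (Fin 2) ℂ

/-- The set of sites at which the coin is not the identity matrix. -/
def perturbedSites (coin : Coin) : Set ℤ := {x | coin x ≠ 1}

/-- The convex hull in `ℝ` of the perturbed sites. -/
def chs (coin : Coin) : Set ℝ := convexHull ℝ ((fun x : ℤ => (x : ℝ)) '' perturbedSites coin)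

/-- The diagonal entries of the coins never vanish, and the perturbation has finite support. -/
structure Admissible (coin : Coin) : Prop where
  diag_ne_zero : ∀ (x : ℤ) (i : Fin 2), (coin x : Matrix (Fin 2) (Fin 2) ℂ) i i ≠ 0
  finite_support : (perturbedSites coin).Finite

/-! ### The time evolution operator -/

/-- The coin operator on all maps `ℤ → ℂ²`. -/
def coinAct (coin : Coin) : (ℤ → Spin) →ₗ[ℂ] (ℤ → Spin) where
  toFun ψ := fun x => Matrix.toEuclideanLin (coin x : Matrix (Fin 2) (Fin 2) ℂ) (ψ x)
  map_add' ψ φ := by ext1 x; simp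
  map_smul' a ψ := by ext1 x; simp

/-- The shift operator on all maps `ℤ → ℂ²`. -/
def shiftAct : (ℤ → Spin) →ₗ[ℂ] (ℤ → Spin) where
  toFun ψ := fun x => !₂[ψ (x + 1) 0, ψ (x - 1) 1]
  map_add' ψ φ := by ext x i; fin_cases i <;> simp
  map_smul' a ψ := by ext x i; fin_cases i <;> simp

/-- The time evolution "shift after coin" on all maps `ℤ → ℂ²`. -/
def walk (coin : Coin) : (ℤ → Spin) →ₗ[ℂ] (ℤ → Spin) := shiftAct ∘ₗ coinAct coin

open scoped Classical in
/-- Multiplication by the characteristic function of `J ⊆ ℝ` on all maps `ℤ → ℂ²`. -/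
def cutoffAct (J : Set ℝ) : (ℤ → Spin) →ₗ[ℂ] (ℤ → Spin) where
  toFun ψ := fun x => if (x : ℝ) ∈ J then ψ x else 0
  map_add' ψ φ := by ext1 x; by_cases h : (x : ℝ) ∈ J <;> simp [h]
  map_smul' a ψ := by ext1 x; by_cases h : (x : ℝ) ∈ J <;> simp [h]

theorem norm_coin (coin : Coin) (x : ℤ) (v : Spin) :
    ‖Matrix.toEuclideanLin (coin x : Matrix (Fin 2) (Fin 2) ℂ) v‖ = ‖v‖ := by
  have h := (coin x).2
  rw [Matrix.mem_unitaryGroup_iff', Matrix.star_eq_conjTranspose] at h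
  have h2 : inner ℂ (Matrix.toEuclideanLin (coin x : Matrix (Fin 2) (Fin 2) ℂ) v)
      (Matrix.toEuclideanLin (coin x : Matrix (Fin 2) (Fin 2) ℂ) v) = inner ℂ v v := by
    rw [← LinearMap.adjoint_inner_left, ← Matrix.toEuclideanLin_conjTranspose_eq_adjoint]
    congr 1
    rw [Matrix.toLpLin_apply, Matrix.toLpLin_apply, WithLp.ofLp_toLp, Matrix.mulVec_mulVec, h,
      Matrix.one_mulVec]
  rw [@norm_eq_sqrt_re_inner ℂ, h2, ← @norm_eq_sqrt_re_inner ℂ]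

theorem walk_bound (coin : Coin) (ψ : ℤ → Spin) (x : ℤ) :
    ‖walk coin ψ x‖ ^ 2 ≤ ‖ψ (Equiv.addRight 1 x)‖ ^ 2 + ‖ψ (Equiv.subRight 1 x)‖ ^ 2 := by
  have h1 := norm_coin coin (x + 1) (ψ (x + 1))
  have h2 := norm_coin coin (x - 1) (ψ (x - 1))
  have e : ‖walk coin ψ x‖ ^ 2
      = ‖coinAct coin ψ (x + 1) 0‖ ^ 2 + ‖coinAct coin ψ (x - 1) 1‖ ^ 2 := by
    simp [walk, shiftAct, EuclideanSpace.norm_sq_eq, Fin.sum_univ_two]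
  have f1 : ‖coinAct coin ψ (x + 1) 0‖ ≤ ‖ψ (x + 1)‖ := by
    rw [← h1]; exact PiLp.norm_apply_le (coinAct coin ψ (x + 1)) 0
  have f2 : ‖coinAct coin ψ (x - 1) 1‖ ≤ ‖ψ (x - 1)‖ := by
    rw [← h2]; exact PiLp.norm_apply_le (coinAct coin ψ (x - 1)) 1
  rw [e]
  simp only [Equiv.coe_addRight, Equiv.subRight_apply]
  gcongr

theorem cutoff_bound (J : Set ℝ) (ψ : ℤ → Spin) (x : ℤ) :
    ‖cutoffAct J ψ x‖ ^ 2 ≤ ‖ψ (Equiv.refl ℤ x)‖ ^ 2 + ‖ψ (Equiv.refl ℤ x)‖ ^ 2 := by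
  by_cases h : (x : ℝ) ∈ J <;> simp [cutoffAct, h]

theorem summable_sq (ψ : Hilb) : Summable fun x : ℤ => ‖ψ x‖ ^ 2 := by
  have := (memℓp_gen_iff (p := 2) (by norm_num)).1 (lp.memℓp ψ)
  simpa using this

/-- A linear map on all maps `ℤ → ℂ²` with a local bound acts as a bounded operator on
`ℓ²(ℤ; ℂ²)`. -/
def restrictToHilb (T : (ℤ → Spin) →ₗ[ℂ] (ℤ → Spin)) (e₁ e₂ : ℤ ≃ ℤ)
    (h : ∀ ψ x, ‖T ψ x‖ ^ 2 ≤ ‖ψ (e₁ x)‖ ^ 2 + ‖ψ (e₂ x)‖ ^ 2) : Hilb →L[ℂ] Hilb :=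
  have hs : ∀ ψ : Hilb, Summable fun x : ℤ => ‖ψ (e₁ x)‖ ^ 2 + ‖ψ (e₂ x)‖ ^ 2 := fun ψ =>
    ((e₁.summable_iff (f := fun x => ‖ψ x‖ ^ 2)).2 (summable_sq ψ)).add
      ((e₂.summable_iff (f := fun x => ‖ψ x‖ ^ 2)).2 (summable_sq ψ))
  have hsT : ∀ ψ : Hilb, Summable fun x : ℤ => ‖T ψ x‖ ^ 2 := fun ψ =>
    Summable.of_nonneg_of_le (fun _ => by positivity) (h ψ) (hs ψ)
  have hm : ∀ ψ : Hilb, Memℓp (T ψ) 2 := fun ψ =>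
    (memℓp_gen_iff (p := 2) (by norm_num)).2 (by simpa using hsT ψ)
  LinearMap.mkContinuous
    { toFun := fun ψ => (⟨T ψ, hm ψ⟩ : Hilb)
      map_add' := fun ψ φ => by
        apply Subtype.ext
        exact T.map_add _ _
      map_smul' := fun a ψ => by
        apply Subtype.ext
        exact T.map_smul _ _ } 2 (fun ψ => by
    apply lp.norm_le_of_tsum_le (by norm_num) (by positivity)
    have h0 : ‖ψ‖ ^ 2 = ∑' x, ‖ψ x‖ ^ 2 := by
      have := lp.norm_rpow_eq_tsum (p := 2) (by norm_num) ψ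
      simpa using this
    have h1 : ∑' x, ‖T ψ x‖ ^ 2 ≤ ∑' x, (‖ψ (e₁ x)‖ ^ 2 + ‖ψ (e₂ x)‖ ^ 2) :=
      (hsT ψ).tsum_le_tsum (h ψ) (hs ψ)
    have h3 := Summable.tsum_add ((e₁.summable_iff (f := fun x => ‖ψ x‖ ^ 2)).2 (summable_sq ψ))
      ((e₂.summable_iff (f := fun x => ‖ψ x‖ ^ 2)).2 (summable_sq ψ))
    have h4 := e₁.tsum_eq (fun x => ‖ψ x‖ ^ 2)
    have h5 := e₂.tsum_eq (fun x => ‖ψ x‖ ^ 2)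
    simp only [Function.comp_def] at h3
    have h2 : ∑' x, ‖T ψ x‖ ^ 2 ≤ (2 * ‖ψ‖) ^ 2 := by nlinarith [sq_nonneg ‖ψ‖, h0, h1, h3, h4, h5]
    simpa using h2)

/-- The time evolution operator `U` on `ℓ²(ℤ; ℂ²)`. -/
def evolution (coin : Coin) : Hilb →L[ℂ] Hilb :=
  restrictToHilb (walk coin) (Equiv.addRight 1) (Equiv.subRight 1) (walk_bound coin)

/-- The operator `𝟙_J` on `ℓ²(ℤ; ℂ²)`. -/
def cutoff (J : Set ℝ) : Hilb →L[ℂ] Hilb :=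
  restrictToHilb (cutoffAct J) (Equiv.refl ℤ) (Equiv.refl ℤ) (cutoff_bound J)

@[simp] theorem evolution_apply (coin : Coin) (ψ : Hilb) (x : ℤ) :
    evolution coin ψ x = walk coin ψ x := rfl

@[simp] theorem cutoff_apply (J : Set ℝ) (ψ : Hilb) (x : ℤ) :
    cutoff J ψ x = cutoffAct J ψ x := rfl

/-! ### Resonances -/

/-- The cut-off resolvent `𝟙_J (U - μ)⁻¹ 𝟙_J`, meant for `|μ| > 1`. -/
def cutoffResolvent (coin : Coin) (J : Set ℝ) (μ : ℂ) : Hilb →L[ℂ] Hilb :=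
  cutoff J * Ring.inverse (evolution coin - μ • 1) * cutoff J

/-- `J` is a bounded interval that contains the convex hull of the perturbed sites. -/
def IsWindow (coin : Coin) (J : Set ℝ) : Prop :=
  J.OrdConnected ∧ Bornology.IsBounded J ∧ chs coin ⊆ J

/-- `R` is a meromorphic extension to `ℂ` of the cut-off resolvent on `|μ| > 1`. -/
def IsExtendedResolvent (coin : Coin) (J : Set ℝ) (R : ℂ → (Hilb →L[ℂ] Hilb)) : Prop :=
  Meromorphic R ∧ ∀ μ : ℂ, 1 < ‖μ‖ → R μ = cutoffResolvent coin J μ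

/-- `a` is a pole of `f` (to be used for meromorphic `f`). -/
def IsPole {E : Type*} [NormedAddCommGroup E] [NormedSpace ℂ E] (f : ℂ → E) (a : ℂ) : Prop :=
  meromorphicOrderAt f a < 0

/-- The integral of `R` over every sufficiently small circle around `a` has rank `m`. -/
def HasMultiplicity (R : ℂ → (Hilb →L[ℂ] Hilb)) (a : ℂ) (m : ℕ) : Prop :=
  ∀ᶠ r : ℝ in 𝓝[>] 0, (circleIntegral R a r).toLinearMap.rank = m

/-! ### Transfer matrices -/

/-- The transfer matrix at the site `x`. In the parametrization
`e^{iθ} [[μ p, q̄], [q, μ⁻¹ p̄]]` one has `e^{iθ} p = 1 / c₁₁`, `e^{iθ} q = c₂₁ / c₁₁`,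
`e^{iθ} q̄ = - c₁₂ / c₁₁` and `e^{iθ} p̄ = det c / c₁₁`. -/
def transfer (coin : Coin) (μ : ℂ) (x : ℤ) : Matrix (Fin 2) (Fin 2) ℂ :=
  let c : Matrix (Fin 2) (Fin 2) ℂ := coin x
  (c 0 0)⁻¹ • !![μ, -c 0 1; c 1 0, μ⁻¹ * c.det]

/-- The vector `(ψ^L(x - 1), ψ^R(x))`. -/
def shiftLeft (ψ : ℤ → Spin) (x : ℤ) : Fin 2 → ℂ := ![ψ (x - 1) 0, ψ x 1]

/-- The transfer matrices propagate the solutions of `(U - μ) ψ = 0`. -/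
theorem walk_eq_smul_iff (coin : Coin) (h : Admissible coin) {μ : ℂ} (hμ : μ ≠ 0)
    (ψ : ℤ → Spin) : walk coin ψ = μ • ψ ↔
      ∀ x, shiftLeft ψ (x + 1) = (transfer coin μ x).mulVec (shiftLeft ψ x) := by
  have h1 : walk coin ψ = μ • ψ ↔ ∀ x : ℤ,
      (coin x : Matrix (Fin 2) (Fin 2) ℂ) 0 0 * ψ x 0
        + (coin x : Matrix (Fin 2) (Fin 2) ℂ) 0 1 * ψ x 1 = μ * ψ (x - 1) 0 ∧
      (coin x : Matrix (Fin 2) (Fin 2) ℂ) 1 0 * ψ x 0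
        + (coin x : Matrix (Fin 2) (Fin 2) ℂ) 1 1 * ψ x 1 = μ * ψ (x + 1) 1 := by
    constructor
    · intro hw x
      have a := congrArg (fun f : ℤ → Spin => f (x - 1) 0) hw
      have b := congrArg (fun f : ℤ → Spin => f (x + 1) 1) hw
      simp [walk, shiftAct, coinAct, Matrix.toLpLin_apply, Matrix.mulVec, dotProduct,
        Fin.sum_univ_two] at a b
      exact ⟨a, b⟩
    · intro hw
      ext x i
      have a := (hw (x + 1)).1
      have b := (hw (x - 1)).2
      rw [add_sub_cancel_right] at a
      rw [sub_add_cancel] at b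
      fin_cases i <;> simp [walk, shiftAct, coinAct, Matrix.toLpLin_apply, Matrix.mulVec,
        dotProduct, Fin.sum_univ_two, a, b]
  rw [h1]
  refine forall_congr' fun x => ?_
  have hc := h.diag_ne_zero x 0
  generalize hA : (coin x : Matrix (Fin 2) (Fin 2) ℂ) = A at hc ⊢
  have e : shiftLeft ψ (x + 1) = (transfer coin μ x).mulVec (shiftLeft ψ x) ↔
      ψ x 0 = (A 0 0)⁻¹ * (μ * ψ (x - 1) 0 - A 0 1 * ψ x 1) ∧
      ψ (x + 1) 1 = (A 0 0)⁻¹ * (A 1 0 * ψ (x - 1) 0 + μ⁻¹ * A.det * ψ x 1) := by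
    rw [funext_iff, Fin.forall_fin_two]
    simp [shiftLeft, transfer, hA, Matrix.mulVec, dotProduct, Fin.sum_univ_two]
    ring_nf
  rw [e, Matrix.det_fin_two]
  constructor
  · rintro ⟨a, b⟩
    have a' : ψ x 0 = (A 0 0)⁻¹ * (μ * ψ (x - 1) 0 - A 0 1 * ψ x 1) := by
      field_simp
      linear_combination a
    refine ⟨a', ?_⟩
    field_simp
    linear_combination A 1 0 * a - A 0 0 * b
  · rintro ⟨a, b⟩
    field_simp at a b
    constructor
    · linear_combination a
    · have : A 0 0 * (A 1 0 * ψ x 0 + A 1 1 * ψ x 1 - μ * ψ (x + 1) 1) = 0 := by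
        linear_combination A 1 0 * a - b
      rcases mul_eq_zero.1 this with h0 | h0
      · exact absurd h0 hc
      · linear_combination h0

/-- The first perturbed site. -/
def firstSite (coin : Coin) : ℤ := sInf (perturbedSites coin)

/-- The last perturbed site. -/
def lastSite (coin : Coin) : ℤ := sSup (perturbedSites coin)

/-- The product `T(x⁺) T(x⁺ - 1) ⋯ T(x⁻)` over all sites from the first perturbed site `x⁻` to
the last one `x⁺`. If no site is perturbed, then it is the transfer matrix of a single
unperturbed site. -/
def totalTransfer (coin : Coin) (μ : ℂ) : Matrix (Fin 2) (Fin 2) ℂ :=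
  ((List.range (lastSite coin - firstSite coin + 1).toNat).map
    fun k : ℕ => transfer coin μ (lastSite coin - k)).prod

/-- The determinant of the total transfer matrix, which does not depend on `μ ≠ 0`. -/
def transferDet (coin : Coin) : ℂ := (totalTransfer coin 1).det

theorem det_totalTransfer (coin : Coin) {μ : ℂ} (hμ : μ ≠ 0) :
    (totalTransfer coin μ).det = transferDet coin := by
  have key : ∀ x, (transfer coin μ x).det = (transfer coin 1 x).det := by
    intro x
    simp only [transfer, Matrix.det_smul, Matrix.det_fin_two_of, ← mul_assoc,
      mul_inv_cancel₀ hμ, inv_one, mul_one]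
  have gen : ∀ (l : List ℕ) (f g : ℕ → Matrix (Fin 2) (Fin 2) ℂ),
      (∀ k, (f k).det = (g k).det) → (l.map f).prod.det = (l.map g).prod.det := by
    intro l f g hfg
    induction l with
    | nil => rfl
    | cons a l ih => simp [Matrix.det_mul, ih, hfg]
  exact gen _ _ _ fun k => key _

/-! ### The scattering matrix -/

/-- The left-going free solution. -/
def freeL (μ : ℂ) (x : ℤ) : Spin := !₂[μ ^ x, 0]

/-- The right-going free solution. -/
def freeR (μ : ℂ) (x : ℤ) : Spin := !₂[0, μ ^ (-x)]

/-- `φ` solves `(U - μ) φ = 0` and coincides with `free μ` near the end `l` of `ℤ`, where `l` is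
`atTop` or `atBot`. -/
def IsJost (coin : Coin) (μ : ℂ) (free : ℂ → ℤ → Spin) (l : Filter ℤ) (φ : ℤ → Spin) : Prop :=
  walk coin φ = μ • φ ∧ ∀ᶠ x in l, φ x = free μ x

/-- `A` is the scattering matrix at `μ`: `(L⁻, R⁺) A = (L⁺, R⁻)` for the Jost solutions, where
`(L⁻, R⁺)` is linearly independent. -/
def IsScatteringMatrixAt (coin : Coin) (μ : ℂ) (A : Matrix (Fin 2) (Fin 2) ℂ) : Prop :=
  ∃ Lm Lp Rm Rp : ℤ → Spin,
    IsJost coin μ freeL atBot Lm ∧ IsJost coin μ freeL atTop Lp ∧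
    IsJost coin μ freeR atBot Rm ∧ IsJost coin μ freeR atTop Rp ∧
    LinearIndependent ℂ ![Lm, Rp] ∧
    Lp = A 0 0 • Lm + A 1 0 • Rp ∧ Rm = A 0 1 • Lm + A 1 1 • Rp

/-- `S` is a meromorphic continuation to `ℂ` of the scattering matrix on the unit circle. -/
def IsExtendedScatteringMatrix (coin : Coin) (S : ℂ → Matrix (Fin 2) (Fin 2) ℂ) : Prop :=
  (∀ i j, Meromorphic fun μ => S μ i j) ∧ ∀ μ : ℂ, ‖μ‖ = 1 → IsScatteringMatrixAt coin μ (S μ)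

/-- The entrywise derivative of a matrix-valued function. -/
def matrixDeriv (S : ℂ → Matrix (Fin 2) (Fin 2) ℂ) (μ : ℂ) : Matrix (Fin 2) (Fin 2) ℂ :=
  Matrix.of fun i j => deriv (fun z => S z i j) μ

end

end QuantumWalk

namespace QuantumWalk

noncomputable section

/-! ### Amplitudes of solutions with respect to the free solutions -/

/-! Write a solution of `(U - μ) ψ = 0` in amplitudes relative to the free waves. They are constant
outside a finite window, and a matrix `M(μ)` (`amp`) carries the left ones to the right ones.
Solving the Jost relations gives `tr S = (1 + det M) / M₀₀` and `det S = M₁₁ / M₀₀`, where `det M =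
Δ` does not depend on `μ` (`isScatteringMatrixAt_iff`, `det_amp_eq_transferDet`, `det_scat`).

For `|μ| > 1`, square summability leaves `(U - μ)⁻¹ 𝟙_J ψ` no incoming wave at the ends of the
window. The cut-off resolvent is therefore `(Z - μ)⁻¹`, with `Z` (`truncWalk`) the compression of
`U` to the `2n`-dimensional space of the window (`cutoffResolvent_eq`). This rational function is
the continuation. Its poles are the eigenvalues of `Z`, and its contour integral is `-2πi` times a
spectral projection, so `m` is an algebraic multiplicity (`range_contourMatrix`).

The bridge is `det (Z - μ) = κ μ^(2n) M₀₀(μ)` with `κ` the product of the `c₁₁` (`det_reflected`).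
Hence `tr S = (1 + Δ) κ μ^(2n) / χ(μ)` with `χ` the characteristic polynomial of `Z`. As `Δ ≠ -1`,
pole orders away from `0` are multiplicities, and `0` is no pole because `χ` has degree `2n`.

For the integral formula, `tr (S' S⁻¹)` is the logarithmic derivative of `det S = κ μ^(2n) M₁₁ / χ`.
Monotonicity of an energy in `x` shows `M₀₀ ≠ 0` for `|μ| ≥ 1` and `M₁₁ ≠ 0` for `0 < |μ| ≤ 1`. So
resonances lie inside the unit disc, and there `M₁₁` cancels no pole.

Two continuations agree on punctured neighbourhoods (`eventuallyEq_of_frequently_eq`). This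
suffices, since orders and integrals over small circles ignore the centre. -/

/-- All perturbed sites lie in `{a, …, a + n - 1}`. -/
def SupportedIn (coin : Coin) (a : ℤ) (n : ℕ) : Prop :=
  ∀ x : ℤ, x < a ∨ a + n ≤ x → coin x = 1

/-- The transfer matrix at `x` between the amplitudes with respect to the free solutions. -/
def ampSite (coin : Coin) (μ : ℂ) (x : ℤ) : Matrix (Fin 2) (Fin 2) ℂ :=
  let c : Matrix (Fin 2) (Fin 2) ℂ := coin x
  (c 0 0)⁻¹ • !![1, -c 0 1 * μ ^ (-2 * x); c 1 0 * μ ^ (2 * x), c.det]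

/-- The amplitude transfer matrix across the sites `a, …, a + n - 1`. -/
def amp (coin : Coin) (a : ℤ) (μ : ℂ) : ℕ → Matrix (Fin 2) (Fin 2) ℂ
  | 0 => 1
  | n + 1 => ampSite coin μ (a + n) * amp coin a μ n

/-- The amplitudes of `ψ` with respect to the free solutions. -/
def amplitude (μ : ℂ) (ψ : ℤ → Spin) (x : ℤ) : Fin 2 → ℂ :=
  ![μ ^ (1 - x) * ψ (x - 1) 0, μ ^ x * ψ x 1]

theorem ampSite_eq_one {coin : Coin} {x : ℤ} (h : coin x = 1) (μ : ℂ) :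
    ampSite coin μ x = 1 := by
  ext i j
  fin_cases i <;> fin_cases j <;> simp [ampSite, h]

/-- Conjugating the transfer matrix by the free waves removes the propagation: an unperturbed site
then contributes the identity. -/
theorem walk_eq_smul_iff_amplitude {coin : Coin} (h : Admissible coin) {μ : ℂ} (hμ : μ ≠ 0)
    (ψ : ℤ → Spin) : walk coin ψ = μ • ψ ↔
      ∀ x, amplitude μ ψ (x + 1) = (ampSite coin μ x).mulVec (amplitude μ ψ x) := by
  rw [walk_eq_smul_iff coin h hμ]
  refine forall_congr' fun x => ?_
  have hx : μ ^ x ≠ 0 := zpow_ne_zero _ hμ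
  rw [funext_iff, Fin.forall_fin_two, funext_iff, Fin.forall_fin_two]
  simp only [shiftLeft, transfer, amplitude, ampSite, Matrix.mulVec, dotProduct, Fin.sum_univ_two,
    Matrix.smul_apply, Matrix.of_apply, Matrix.cons_val', Matrix.cons_val_zero,
    Matrix.cons_val_one, Matrix.cons_val_fin_one, smul_eq_mul, add_sub_cancel_right]
  generalize (coin x : Matrix (Fin 2) (Fin 2) ℂ) = A
  have e1 : μ ^ (1 - (x + 1)) = (μ ^ x)⁻¹ := by rw [← zpow_neg]; congr 1; ring
  have e2 : μ ^ (1 - x) = μ * (μ ^ x)⁻¹ := by rw [zpow_sub₀ hμ]; simp [div_eq_mul_inv]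
  have e3 : μ ^ (-2 * x) = (μ ^ x)⁻¹ ^ 2 := by
    rw [← zpow_neg, ← zpow_natCast, ← zpow_mul]; congr 1; push_cast; ring
  have e4 : μ ^ (2 * x) = (μ ^ x) ^ 2 := by
    rw [← zpow_natCast, ← zpow_mul]; congr 1; push_cast; ring
  have e5 : μ ^ (x + 1) = μ ^ x * μ := zpow_add_one₀ hμ x
  rw [e1, e2, e3, e4, e5]
  generalize μ ^ x = z at hx
  refine and_congr ⟨fun H => ?_, fun H => ?_⟩ ⟨fun H => ?_, fun H => ?_⟩
  · rw [H]; field_simp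
  · have := congrArg (z * ·) H
    simp only [mul_inv_cancel_left₀ hx] at this
    rw [this]; field_simp
  · rw [H]; field_simp
  · have := congrArg (fun t => (z * μ)⁻¹ * t) H
    simp only [inv_mul_cancel_left₀ (mul_ne_zero hx hμ)] at this
    rw [this]; field_simp

/-- The solution with amplitudes `v` to the left of the site `a`. -/
def sol (coin : Coin) (a : ℤ) (μ : ℂ) (v : Fin 2 → ℂ) (x : ℤ) : Spin :=
  !₂[μ ^ x * (amp coin a μ (x + 1 - a).toNat).mulVec v 0,
    μ ^ (-x) * (amp coin a μ (x - a).toNat).mulVec v 1]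

theorem amplitude_sol {coin : Coin} {a : ℤ} {μ : ℂ} (hμ : μ ≠ 0) (v : Fin 2 → ℂ) (x : ℤ) :
    amplitude μ (sol coin a μ v) x = (amp coin a μ (x - a).toNat).mulVec v := by
  have hx : μ ^ x ≠ 0 := zpow_ne_zero _ hμ
  have e : μ ^ (1 - x) * μ ^ (x - 1) = 1 := by rw [← zpow_add₀ hμ]; simp
  ext i
  fin_cases i
  · simp [amplitude, sol, ← mul_assoc, e]
  · simp [amplitude, sol, hx]

theorem amplitude_injective {μ : ℂ} (hμ : μ ≠ 0) {φ ψ : ℤ → Spin}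
    (h : ∀ x, amplitude μ φ x = amplitude μ ψ x) : φ = ψ := by
  ext x i
  fin_cases i
  · have := congrFun (h (x + 1)) 0
    simpa [amplitude, zpow_ne_zero _ hμ] using this
  · have := congrFun (h x) 1
    simpa [amplitude, zpow_ne_zero _ hμ] using this

/-- Left of `a` both differences truncate to `0`, which is consistent because the site matrix there
is `1`. One recursion thus serves all of `ℤ`. -/
theorem amp_succ_toNat {coin : Coin} {a : ℤ} {n : ℕ} (hs : SupportedIn coin a n) (μ : ℂ) (x : ℤ) :
    amp coin a μ (x + 1 - a).toNat = ampSite coin μ x * amp coin a μ (x - a).toNat := by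
  rcases lt_or_ge x a with hx | hx
  · have h1 : (x + 1 - a).toNat = 0 := by omega
    have h2 : (x - a).toNat = 0 := by omega
    rw [h1, h2, ampSite_eq_one (hs x (Or.inl hx)), one_mul]
  · have h1 : (x + 1 - a).toNat = (x - a).toNat + 1 := by omega
    rw [h1, amp]
    congr 2
    omega

theorem amp_of_le {coin : Coin} {a : ℤ} {n : ℕ} (hs : SupportedIn coin a n) (μ : ℂ) {m : ℕ}
    (hm : n ≤ m) : amp coin a μ m = amp coin a μ n := by
  induction m, hm using Nat.le_induction with
  | base => rfl
  | succ m hm ih => rw [amp, ih, ampSite_eq_one (hs _ (Or.inr (by omega))), one_mul]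

theorem walk_sol {coin : Coin} (h : Admissible coin) {a : ℤ} {n : ℕ}
    (hs : SupportedIn coin a n) {μ : ℂ} (hμ : μ ≠ 0) (v : Fin 2 → ℂ) :
    walk coin (sol coin a μ v) = μ • sol coin a μ v := by
  rw [walk_eq_smul_iff_amplitude h hμ]
  intro x
  rw [amplitude_sol hμ, amplitude_sol hμ, amp_succ_toNat hs, Matrix.mulVec_mulVec]

/-- The powers of `μ` cancel in the off-diagonal product, and `det c + c₁₂ c₂₁ = c₁₁ c₂₂`. -/
theorem det_ampSite {coin : Coin} (h : Admissible coin) {μ : ℂ} (hμ : μ ≠ 0) (x : ℤ) :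
    (ampSite coin μ x).det = (coin x : Matrix (Fin 2) (Fin 2) ℂ) 1 1 /
      (coin x : Matrix (Fin 2) (Fin 2) ℂ) 0 0 := by
  have h0 := h.diag_ne_zero x 0
  have hx : μ ^ (2 * x) ≠ 0 := zpow_ne_zero _ hμ
  have e : μ ^ (-2 * x) = (μ ^ (2 * x))⁻¹ := by rw [← zpow_neg]; congr 1; ring
  simp only [ampSite, Matrix.det_smul, Matrix.det_fin_two, e, Matrix.of_apply, Matrix.cons_val',
    Matrix.cons_val_zero, Matrix.cons_val_one, Matrix.cons_val_fin_one, Fintype.card_fin]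
  field_simp
  ring

/-- The amplitudes at `a` determine a solution: to the right through the recursion, to the left
because they stay constant. -/
theorem eq_sol {coin : Coin} (h : Admissible coin) {a : ℤ} {n : ℕ}
    (hs : SupportedIn coin a n) {μ : ℂ} (hμ : μ ≠ 0) {φ : ℤ → Spin}
    (hφ : walk coin φ = μ • φ) : φ = sol coin a μ (amplitude μ φ a) := by
  rw [walk_eq_smul_iff_amplitude h hμ] at hφ
  refine amplitude_injective hμ fun x => ?_
  rw [amplitude_sol hμ]
  have h1 : ∀ k : ℕ, amplitude μ φ (a + k) = (amp coin a μ k).mulVec (amplitude μ φ a) := by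
    intro k
    induction k with
    | zero => simp [amp]
    | succ k ih => rw [amp, ← Matrix.mulVec_mulVec, ← ih, ← hφ]; congr 1; push_cast; ring
  have h2 : ∀ k : ℕ, amplitude μ φ (a - k) = amplitude μ φ a := by
    intro k
    induction k with
    | zero => simp
    | succ k ih =>
      rw [← ih]
      have := hφ (a - (k + 1 : ℕ))
      rw [ampSite_eq_one (hs _ (Or.inl (by omega))), Matrix.one_mulVec] at this
      rw [← this]; congr 1; push_cast; ring
  rcases le_total a x with hx | hx
  · rw [← h1]; congr 1; omega
  · have e : (x - a).toNat = 0 := by omega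
    rw [e, amp, Matrix.one_mulVec, ← h2 (a - x).toNat]; congr 1; omega

theorem amplitude_add_nat {coin : Coin} (h : Admissible coin) {a : ℤ} {n : ℕ}
    (hs : SupportedIn coin a n) {μ : ℂ} (hμ : μ ≠ 0) {φ : ℤ → Spin}
    (hφ : walk coin φ = μ • φ) {x : ℤ} (hx : a + n ≤ x) :
    amplitude μ φ x = (amp coin a μ n).mulVec (amplitude μ φ a) := by
  conv_lhs => rw [eq_sol h hs hμ hφ]
  rw [amplitude_sol hμ, amp_of_le hs μ (by omega)]

theorem amplitude_of_le {coin : Coin} (h : Admissible coin) {a : ℤ} {n : ℕ}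
    (hs : SupportedIn coin a n) {μ : ℂ} (hμ : μ ≠ 0) {φ : ℤ → Spin}
    (hφ : walk coin φ = μ • φ) {x : ℤ} (hx : x ≤ a) :
    amplitude μ φ x = amplitude μ φ a := by
  conv_lhs => rw [eq_sol h hs hμ hφ]
  have e : (x - a).toNat = 0 := by omega
  rw [amplitude_sol hμ, e, amp, Matrix.one_mulVec]

theorem amplitude_freeL {μ : ℂ} (hμ : μ ≠ 0) (x : ℤ) : amplitude μ (freeL μ) x = ![1, 0] := by
  have e : μ ^ (1 - x) * μ ^ (x - 1) = 1 := by rw [← zpow_add₀ hμ]; simp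
  simp [amplitude, freeL, e]

theorem amplitude_freeR {μ : ℂ} (hμ : μ ≠ 0) (x : ℤ) : amplitude μ (freeR μ) x = ![0, 1] := by
  simp [amplitude, freeR, zpow_ne_zero _ hμ]

theorem eq_of_amplitude_eq {μ : ℂ} (hμ : μ ≠ 0) {φ ψ : ℤ → Spin} {x : ℤ}
    (h1 : amplitude μ φ x = amplitude μ ψ x) (h2 : amplitude μ φ (x + 1) = amplitude μ ψ (x + 1)) :
    φ x = ψ x := by
  ext i
  fin_cases i
  · have := congrFun h2 0
    simpa [amplitude, zpow_ne_zero _ hμ] using this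
  · have := congrFun h1 1
    simpa [amplitude, zpow_ne_zero _ hμ] using this

/-- A solution is a Jost solution at `-∞` iff its left amplitudes are those of the free one. -/
theorem isJost_atBot_iff {coin : Coin} (h : Admissible coin) {a : ℤ} {n : ℕ}
    (hs : SupportedIn coin a n) {μ : ℂ} (hμ : μ ≠ 0) {free : ℂ → ℤ → Spin} {v : Fin 2 → ℂ}
    (hfree : ∀ x, amplitude μ (free μ) x = v) {φ : ℤ → Spin} :
    IsJost coin μ free atBot φ ↔ walk coin φ = μ • φ ∧ amplitude μ φ a = v := by
  refine and_congr_right fun hφ => ⟨fun H => ?_, fun H => ?_⟩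
  · obtain ⟨N, hN⟩ := eventually_atBot.1 H
    rw [← amplitude_of_le h hs hμ hφ (x := min N a) (min_le_right _ _), ← hfree (min N a)]
    simp only [amplitude]
    rw [hN _ (min_le_left _ _), hN (min N a - 1) (by have := min_le_left N a; omega)]
  -- The spin at `x` is read off from the amplitudes at `x` and `x + 1`; the bound `a - 1` keeps
  -- both positions at or left of `a`.
  · refine eventually_atBot.2 ⟨a - 1, fun x hx => eq_of_amplitude_eq hμ ?_ ?_⟩
    · rw [hfree, amplitude_of_le h hs hμ hφ (by omega), H]
    · rw [hfree, amplitude_of_le h hs hμ hφ (by omega), H]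

/-- A solution is a Jost solution at `+∞` iff its right amplitudes are those of the free one. -/
theorem isJost_atTop_iff {coin : Coin} (h : Admissible coin) {a : ℤ} {n : ℕ}
    (hs : SupportedIn coin a n) {μ : ℂ} (hμ : μ ≠ 0) {free : ℂ → ℤ → Spin} {v : Fin 2 → ℂ}
    (hfree : ∀ x, amplitude μ (free μ) x = v) {φ : ℤ → Spin} :
    IsJost coin μ free atTop φ ↔
      walk coin φ = μ • φ ∧ (amp coin a μ n).mulVec (amplitude μ φ a) = v := by
  refine and_congr_right fun hφ => ⟨fun H => ?_, fun H => ?_⟩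
  · obtain ⟨N, hN⟩ := eventually_atTop.1 H
    -- The amplitude at a position also involves the site before it, hence `N + 1` rather than `N`.
    have h1 : N + 1 ≤ max (N + 1) (a + n) := le_max_left _ _
    rw [← amplitude_add_nat h hs hμ hφ (x := max (N + 1) (a + n)) (le_max_right _ _),
      ← hfree (max (N + 1) (a + n))]
    simp only [amplitude]
    rw [hN (max (N + 1) (a + n)) (by omega), hN (max (N + 1) (a + n) - 1) (by omega)]
  · refine eventually_atTop.2 ⟨a + n, fun x hx => eq_of_amplitude_eq hμ ?_ ?_⟩
    · rw [hfree, amplitude_add_nat h hs hμ hφ (by omega), H]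
    · rw [hfree, amplitude_add_nat h hs hμ hφ (by omega), H]

theorem det_amp {coin : Coin} (h : Admissible coin) {μ : ℂ} (hμ : μ ≠ 0) (a : ℤ) (n : ℕ) :
    (amp coin a μ n).det = ∏ k ∈ Finset.range n,
      ((coin (a + k) : Matrix (Fin 2) (Fin 2) ℂ) 1 1 /
        (coin (a + k) : Matrix (Fin 2) (Fin 2) ℂ) 0 0) := by
  induction n with
  | zero => simp [amp]
  | succ n ih => rw [amp, Matrix.det_mul, ih, Finset.prod_range_succ, det_ampSite h hμ, mul_comm]

theorem sol_add_smul (coin : Coin) (a : ℤ) (μ s t : ℂ) (v w : Fin 2 → ℂ) :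
    s • sol coin a μ v + t • sol coin a μ w = sol coin a μ (s • v + t • w) := by
  ext x i
  fin_cases i <;> simp [sol, Matrix.mulVec_add, Matrix.mulVec_smul] <;> ring

theorem amplitude_add_smul (μ s t : ℂ) (φ ψ : ℤ → Spin) (x : ℤ) :
    amplitude μ (s • φ + t • ψ) x = s • amplitude μ φ x + t • amplitude μ ψ x := by
  ext i
  fin_cases i <;> simp [amplitude] <;> ring

/-! ### Energy estimates -/

/-- The coin at `x` is unitary, and the eigenvalue equation identifies its two outputs with `μ ψ^L(x
- 1)` and `μ ψ^R(x + 1)`. -/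
theorem norm_sq_conservation {coin : Coin} {μ : ℂ} {ψ : ℤ → Spin}
    (hψ : walk coin ψ = μ • ψ) (x : ℤ) :
    ‖ψ x 0‖ ^ 2 + ‖ψ x 1‖ ^ 2 = ‖μ‖ ^ 2 * (‖ψ (x - 1) 0‖ ^ 2 + ‖ψ (x + 1) 1‖ ^ 2) := by
  have a := congrArg (fun f : ℤ → Spin => f (x - 1) 0) hψ
  have b := congrArg (fun f : ℤ → Spin => f (x + 1) 1) hψ
  have n := congrArg (· ^ 2) (norm_coin coin x (ψ x))
  simp only [EuclideanSpace.norm_sq_eq, Fin.sum_univ_two] at n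
  simp [walk, shiftAct] at a b
  change (coinAct coin ψ x) 0 = _ at a
  change (coinAct coin ψ x) 1 = _ at b
  change ‖(coinAct coin ψ x) 0‖ ^ 2 + ‖(coinAct coin ψ x) 1‖ ^ 2 = _ at n
  rw [← n, a, b, norm_mul, norm_mul]
  ring

/-- The energy of the pair `(ψ^L(x - 1), ψ^R(x))`. -/
def energy (ψ : ℤ → Spin) (x : ℤ) : ℝ := ‖ψ (x - 1) 0‖ ^ 2 - ‖ψ x 1‖ ^ 2

/-- By `norm_sq_conservation` the increment equals `(‖μ‖² - 1)(‖ψ^L(x - 1)‖² + ‖ψ^R(x + 1)‖²)`. -/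
theorem energy_le_succ {coin : Coin} {μ : ℂ} {ψ : ℤ → Spin} (hψ : walk coin ψ = μ • ψ)
    (hμ : 1 ≤ ‖μ‖) (x : ℤ) : energy ψ x ≤ energy ψ (x + 1) := by
  have h := norm_sq_conservation hψ x
  have h2 : 0 ≤ ‖μ‖ ^ 2 - 1 := by nlinarith
  simp only [energy, add_sub_cancel_right]
  nlinarith [mul_nonneg h2 (sq_nonneg ‖ψ (x - 1) 0‖), mul_nonneg h2 (sq_nonneg ‖ψ (x + 1) 1‖)]

theorem energy_succ_le {coin : Coin} {μ : ℂ} {ψ : ℤ → Spin} (hψ : walk coin ψ = μ • ψ)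
    (hμ : ‖μ‖ ≤ 1) (x : ℤ) : energy ψ (x + 1) ≤ energy ψ x := by
  have h := norm_sq_conservation hψ x
  have h2 : 0 ≤ 1 - ‖μ‖ ^ 2 := by nlinarith [norm_nonneg μ]
  simp only [energy, add_sub_cancel_right]
  nlinarith [mul_nonneg h2 (sq_nonneg ‖ψ (x - 1) 0‖), mul_nonneg h2 (sq_nonneg ‖ψ (x + 1) 1‖)]

/-- The solution with left amplitudes `(1, 0)` has positive energy at `a`, and energy does not
decrease to the right. A vanishing entry would make the energy at `a + n` non-positive. -/
theorem amp_zero_zero_ne_zero {coin : Coin} (h : Admissible coin) {a : ℤ} {n : ℕ}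
    (hs : SupportedIn coin a n) {μ : ℂ} (hμ : 1 ≤ ‖μ‖) : amp coin a μ n 0 0 ≠ 0 := by
  have h0 : μ ≠ 0 := by rintro rfl; simp at hμ; linarith
  have hφ := walk_sol h hs h0 ![1, 0]
  set φ := sol coin a μ ![1, 0] with hφdef
  have mono : ∀ k : ℕ, energy φ a ≤ energy φ (a + k) := by
    intro k
    induction k with
    | zero => simp
    | succ k ih => exact ih.trans ((energy_le_succ hφ hμ _).trans_eq (by congr 1; push_cast; ring))
  intro H
  have e1 : 0 < energy φ a := by
    simp [energy, hφdef, sol, amp]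
    positivity
  have e2 := mono n
  simp [energy, hφdef, sol, Matrix.mulVec, dotProduct, H] at e1 e2
  nlinarith [sq_nonneg (‖μ ^ (a + n)‖⁻¹ * ‖amp coin a μ n 1 0‖)]

/-- Mirror image of `amp_zero_zero_ne_zero`: left amplitudes `(0, 1)` start with negative energy,
which cannot increase. -/
theorem amp_one_one_ne_zero {coin : Coin} (h : Admissible coin) {a : ℤ} {n : ℕ}
    (hs : SupportedIn coin a n) {μ : ℂ} (h0 : μ ≠ 0) (hμ : ‖μ‖ ≤ 1) : amp coin a μ n 1 1 ≠ 0 := by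
  have hφ := walk_sol h hs h0 ![0, 1]
  set φ := sol coin a μ ![0, 1] with hφdef
  have mono : ∀ k : ℕ, energy φ (a + k) ≤ energy φ a := by
    intro k
    induction k with
    | zero => simp
    | succ k ih =>
      exact le_trans (le_of_eq_of_le (by congr 1; push_cast; ring) (energy_succ_le hφ hμ _)) ih
  intro H
  have e1 : 0 < -energy φ a := by
    simp [energy, hφdef, sol, amp]
    positivity
  have e2 := mono n
  simp [energy, hφdef, sol, Matrix.mulVec, dotProduct, H] at e1 e2
  nlinarith [sq_nonneg (‖μ ^ (a + n - 1)‖ * ‖amp coin a μ n 0 1‖)]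

/-! ### The scattering matrix in terms of amplitudes -/

/-- The scattering matrix computed from the amplitude transfer matrix. -/
def scat (coin : Coin) (a : ℤ) (n : ℕ) (μ : ℂ) : Matrix (Fin 2) (Fin 2) ℂ :=
  let M := amp coin a μ n
  !![(M 0 0)⁻¹, M 0 1 / M 0 0; -M 1 0 / M 0 0, M.det / M 0 0]

/-- Read at the right end, the four Jost solutions have amplitudes `M e₀`, `e₀`, `M e₁`, `e₁`. The
defining relations become two linear systems, uniquely solvable because `M₀₀ ≠ 0`. -/
theorem isScatteringMatrixAt_iff {coin : Coin} (h : Admissible coin) {a : ℤ} {n : ℕ}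
    (hs : SupportedIn coin a n) {μ : ℂ} (hμ : ‖μ‖ = 1) (A : Matrix (Fin 2) (Fin 2) ℂ) :
    IsScatteringMatrixAt coin μ A ↔ A = scat coin a n μ := by
  have h0 : μ ≠ 0 := by rintro rfl; simp at hμ
  have hM := amp_zero_zero_ne_zero h hs hμ.ge
  have hdet : (amp coin a μ n).det ≠ 0 := by
    rw [det_amp h h0]
    exact Finset.prod_ne_zero_iff.2 fun k _ =>
      div_ne_zero (h.diag_ne_zero _ 1) (h.diag_ne_zero _ 0)
  simp only [IsScatteringMatrixAt, isJost_atBot_iff h hs h0 (amplitude_freeL h0),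
    isJost_atBot_iff h hs h0 (amplitude_freeR h0), isJost_atTop_iff h hs h0 (amplitude_freeL h0),
    isJost_atTop_iff h hs h0 (amplitude_freeR h0)]
  have amp_sol : ∀ v, amplitude μ (sol coin a μ v) a = v := fun v => by
    rw [amplitude_sol h0]; simp [amp]
  set M := amp coin a μ n with hMdef
  constructor
  · rintro ⟨Lm, Lp, Rm, Rp, ⟨-, hLm⟩, ⟨-, hLp⟩, ⟨-, hRm⟩, ⟨-, hRp⟩, -, e1, e2⟩
    -- A reflexive equation, of which only the right side is then rewritten by the scattering
    -- relation.
    have f1 : M.mulVec (amplitude μ Lp a) = M.mulVec (amplitude μ Lp a) := rfl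
    have f2 : M.mulVec (amplitude μ Rm a) = M.mulVec (amplitude μ Rm a) := rfl
    conv_rhs at f1 => rw [e1]
    conv_rhs at f2 => rw [e2]
    rw [amplitude_add_smul, Matrix.mulVec_add, Matrix.mulVec_smul, Matrix.mulVec_smul, hLp, hLm,
      hRp] at f1
    rw [amplitude_add_smul, Matrix.mulVec_add, Matrix.mulVec_smul, Matrix.mulVec_smul, hRm, hLm,
      hRp] at f2
    rw [funext_iff, Fin.forall_fin_two] at f1 f2
    simp [Matrix.mulVec, dotProduct] at f1 f2
    obtain ⟨f11, f12⟩ := f1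
    obtain ⟨f21, f22⟩ := f2
    have g1 : A 0 0 = (M 0 0)⁻¹ := eq_inv_of_mul_eq_one_left f11.symm
    have g2 : A 0 1 = M 0 1 / M 0 0 := by rw [f21]; field_simp
    have g3 : A 1 0 = -M 1 0 / M 0 0 := by
      rw [g1] at f12; rw [neg_div, div_eq_inv_mul]; linear_combination -f12
    have g4 : A 1 1 = M.det / M 0 0 := by
      rw [g2] at f22; rw [Matrix.det_fin_two]; field_simp at f22 ⊢; linear_combination -f22
    ext i j
    fin_cases i <;> fin_cases j <;> simp [scat, ← hMdef, g1, g2, g3, g4]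
  · rintro rfl
    have hinv : ∀ v, M.mulVec (M⁻¹.mulVec v) = v := fun v => by
      rw [Matrix.mulVec_mulVec, Matrix.mul_nonsing_inv _ (isUnit_iff_ne_zero.2 hdet),
        Matrix.one_mulVec]
    have hinj : Function.Injective M.mulVec := fun v w hvw => by
      have := congrArg (M⁻¹.mulVec) hvw
      simpa only [Matrix.mulVec_mulVec, Matrix.nonsing_inv_mul _ (isUnit_iff_ne_zero.2 hdet),
        Matrix.one_mulVec] using this
    refine ⟨sol coin a μ ![1, 0], sol coin a μ (M⁻¹.mulVec ![1, 0]), sol coin a μ ![0, 1],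
      sol coin a μ (M⁻¹.mulVec ![0, 1]), ⟨walk_sol h hs h0 _, amp_sol _⟩,
      ⟨walk_sol h hs h0 _, by rw [amp_sol, hinv]⟩, ⟨walk_sol h hs h0 _, amp_sol _⟩,
      ⟨walk_sol h hs h0 _, by rw [amp_sol, hinv]⟩, ?_, ?_, ?_⟩
    · rw [LinearIndependent.pair_iff]
      intro s t hst
      rw [sol_add_smul] at hst
      have := congrArg (fun φ => M.mulVec (amplitude μ φ a)) hst
      have z : amplitude μ 0 a = 0 := by ext i; fin_cases i <;> simp [amplitude]
      simp only [amp_sol, z, Matrix.mulVec_add, Matrix.mulVec_smul, hinv, Matrix.mulVec_zero] at this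
      rw [funext_iff, Fin.forall_fin_two] at this
      simp [Matrix.mulVec, dotProduct, hM] at this
      obtain ⟨rfl, h2⟩ := this
      simpa using h2
    · rw [sol_add_smul]
      congr 1
      apply hinj
      simp only [Matrix.mulVec_add, Matrix.mulVec_smul, hinv]
      ext i
      fin_cases i
      · simp [scat, ← hMdef, Matrix.mulVec, dotProduct, hM]
      · simp [scat, ← hMdef, Matrix.mulVec, dotProduct]
        ring
    · rw [sol_add_smul]
      congr 1
      apply hinj
      simp only [Matrix.mulVec_add, Matrix.mulVec_smul, hinv]
      ext i
      fin_cases i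
      · simp [scat, ← hMdef, Matrix.mulVec, dotProduct, hM]
      · simp [scat, ← hMdef, Matrix.mulVec, dotProduct, Matrix.det_fin_two]
        field_simp
        ring

/-! ### The determinant of the transfer matrix -/

theorem det_transfer_one {coin : Coin} (h : Admissible coin) (x : ℤ) :
    (transfer coin 1 x).det = (coin x : Matrix (Fin 2) (Fin 2) ℂ) 1 1 /
      (coin x : Matrix (Fin 2) (Fin 2) ℂ) 0 0 := by
  have h0 := h.diag_ne_zero x 0
  simp only [transfer, Matrix.det_smul, Matrix.det_fin_two, Matrix.of_apply, Matrix.cons_val',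
    Matrix.cons_val_zero, Matrix.cons_val_one, Matrix.cons_val_fin_one, Fintype.card_fin]
  field_simp
  ring

theorem mulSupport_diag_ratio (coin : Coin) :
    (Function.mulSupport fun x => (coin x : Matrix (Fin 2) (Fin 2) ℂ) 1 1 /
      (coin x : Matrix (Fin 2) (Fin 2) ℂ) 0 0) ⊆ perturbedSites coin := by
  intro x hx hc
  exact hx (by simp [hc])

/-- A product over all of `ℤ` does not depend on a window, so the product over the hull can be
compared with `amp` on any larger window. -/
theorem transferDet_eq_finprod {coin : Coin} (h : Admissible coin) :
    transferDet coin = ∏ᶠ x : ℤ, (coin x : Matrix (Fin 2) (Fin 2) ℂ) 1 1 /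
      (coin x : Matrix (Fin 2) (Fin 2) ℂ) 0 0 := by
  have hb := h.finite_support.bddBelow
  have ha := h.finite_support.bddAbove
  set s : Finset ℤ := (Finset.range (lastSite coin - firstSite coin + 1).toNat).image
    (fun k : ℕ => lastSite coin - k) with hs
  have hsub : perturbedSites coin ⊆ s := by
    intro x hx
    have h1 : firstSite coin ≤ x := csInf_le hb hx
    have h2 : x ≤ lastSite coin := le_csSup ha hx
    simp only [hs, Finset.coe_image, Set.mem_image, Finset.coe_range, Set.mem_Iio]
    exact ⟨(lastSite coin - x).toNat, by omega, by omega⟩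
  rw [finprod_eq_prod_of_mulSupport_subset _ ((mulSupport_diag_ratio coin).trans hsub), hs,
    Finset.prod_image (fun i _ j _ hij => by simpa using hij), transferDet, totalTransfer]
  generalize (lastSite coin - firstSite coin + 1).toNat = m
  induction m with
  | zero => simp
  | succ m ih =>
    rw [List.range_succ, List.map_append, List.prod_append, Matrix.det_mul, ih,
      Finset.prod_range_succ]
    simp [det_transfer_one h]

theorem det_amp_eq_transferDet {coin : Coin} (h : Admissible coin) {a : ℤ} {n : ℕ}
    (hs : SupportedIn coin a n) {μ : ℂ} (hμ : μ ≠ 0) :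
    (amp coin a μ n).det = transferDet coin := by
  rw [det_amp h hμ, transferDet_eq_finprod h,
    finprod_eq_prod_of_mulSupport_subset (s := (Finset.range n).image fun k : ℕ => a + k),
    Finset.prod_image (fun i _ j _ hij => by simpa using hij)]
  intro x hx
  have hx' : coin x ≠ 1 := mulSupport_diag_ratio coin hx
  by_contra hc
  refine hx' (hs x ?_)
  by_contra! hlt
  refine hc ?_
  simp only [Finset.coe_image, Set.mem_image, Finset.coe_range, Set.mem_Iio]
  exact ⟨(x - a).toNat, by omega, by omega⟩

theorem transferDet_eq_one {coin : Coin} (h : Admissible coin)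
    (hd : ∀ x, (coin x : Matrix (Fin 2) (Fin 2) ℂ) 0 0 =
      (coin x : Matrix (Fin 2) (Fin 2) ℂ) 1 1) : transferDet coin = 1 := by
  rw [transferDet_eq_finprod h]
  refine (finprod_congr fun x => ?_).trans finprod_one
  rw [← hd, div_self (h.diag_ne_zero x 0)]

/-! ### The truncated walk and its characteristic polynomial -/

/-- The compression of the walk to the sites `a, …, a + n - 1`. -/
def truncWalk (coin : Coin) (a : ℤ) (n : ℕ) : Matrix (Fin n × Fin 2) (Fin n × Fin 2) ℂ :=
  Matrix.of fun p q =>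
    if p.2 = 0 then
      if (q.1 : ℕ) = p.1 + 1 then (coin (a + q.1) : Matrix (Fin 2) (Fin 2) ℂ) 0 q.2 else 0
    else
      if (q.1 : ℕ) + 1 = p.1 then (coin (a + q.1) : Matrix (Fin 2) (Fin 2) ℂ) 1 q.2 else 0

/-- The matrix that feeds the right-moving output of the last site back into its left-moving
entry. -/
def reflector (coin : Coin) (a : ℤ) (n : ℕ) : Matrix (Fin n × Fin 2) (Fin n × Fin 2) ℂ :=
  Matrix.of fun p q =>
    if p.2 = 0 ∧ (p.1 : ℕ) + 1 = n ∧ (q.1 : ℕ) + 1 = n then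
      (coin (a + q.1) : Matrix (Fin 2) (Fin 2) ℂ) 1 q.2 else 0

/-- Splitting off the last site. -/
def splitLast (n : ℕ) : (Fin n × Fin 2) ⊕ Fin 2 ≃ Fin (n + 1) × Fin 2 :=
  Equiv.ofBijective
    (Sum.elim (fun p => (p.1.castSucc, p.2)) fun i => (Fin.last n, i)) (by
    constructor
    · rintro (⟨k, i⟩ | i) (⟨l, j⟩ | j) h
      · simpa using h
      · simp only [Sum.elim_inl, Sum.elim_inr, Prod.mk.injEq] at h
        exact absurd h.1 (Fin.castSucc_lt_last k).ne
      · simp only [Sum.elim_inl, Sum.elim_inr, Prod.mk.injEq] at h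
        exact absurd h.1.symm (Fin.castSucc_lt_last l).ne
      · simpa using h
    · rintro ⟨k, i⟩
      induction k using Fin.lastCases with
      | last => exact ⟨Sum.inr i, rfl⟩
      | cast k => exact ⟨Sum.inl (k, i), rfl⟩)

@[simp] theorem splitLast_inl (n : ℕ) (p : Fin n × Fin 2) :
    splitLast n (Sum.inl p) = (p.1.castSucc, p.2) := rfl

@[simp] theorem splitLast_inr (n : ℕ) (i : Fin 2) :
    splitLast n (Sum.inr i) = (Fin.last n, i) := rfl

/-- The truncated walk minus `μ`, with reflection coefficient `ρ` at the right end. -/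
def reflected (coin : Coin) (a : ℤ) (n : ℕ) (μ ρ : ℂ) :
    Matrix (Fin n × Fin 2) (Fin n × Fin 2) ℂ :=
  truncWalk coin a n - Matrix.scalar _ μ + ρ • reflector coin a n

/-- A Schur complement eliminates the last site. What remains is the shorter walk with a new mirror
at its end, the coefficient changing by a Möbius map; allowing a mirror is what closes the induction
on `n`. -/
theorem det_reflected_succ {coin : Coin} {a : ℤ} {n : ℕ} {μ ρ : ℂ}
    (hμ : μ ≠ 0) {c : Matrix (Fin 2) (Fin 2) ℂ} (hc : (coin (a + n) : Matrix _ _ ℂ) = c)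
    (hρ : μ - ρ * c 1 0 ≠ 0) :
    (reflected coin a (n + 1) μ ρ).det = μ * (μ - ρ * c 1 0) *
      (reflected coin a n μ ((c 0 1 + ρ * c.det / μ) / (μ - ρ * c 1 0))).det := by
  set p := μ - ρ * c 1 0 with hp
  rw [← Matrix.det_submatrix_equiv_self (splitLast n)]
  set X := (reflected coin a (n + 1) μ ρ).submatrix (splitLast n) (splitLast n) with hX
  have hD : X.toBlocks₂₂ = !![-p, ρ * c 1 1; 0, -μ] := by
    ext i j
    fin_cases i <;> fin_cases j <;>
      simp [X, reflected, truncWalk, reflector, Matrix.toBlocks₂₂, Matrix.scalar_apply, hc, p]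
    ring
  have hB : X.toBlocks₁₂ = Matrix.of fun k j =>
      if k.2 = 0 ∧ (k.1 : ℕ) + 1 = n then c 0 j else 0 := by
    ext ⟨k, i⟩ j
    have h1 := k.2
    have h2 : n ≠ (k : ℕ) := by omega
    have h3 : ¬ (n + 1 = (k : ℕ)) := by omega
    have h4 : ¬ (k.castSucc = Fin.last n) := (Fin.castSucc_lt_last k).ne
    have h5 : (n = (k : ℕ) + 1) = ((k : ℕ) + 1 = n) := propext eq_comm
    fin_cases i <;>
    simp [X, reflected, truncWalk, reflector, Matrix.toBlocks₁₂, Matrix.scalar_apply, hc,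
      Matrix.diagonal_apply, h2.symm, h3, h4, h5]
  have hC : X.toBlocks₂₁ = Matrix.of fun i q =>
      if i = 1 ∧ (q.1 : ℕ) + 1 = n then (coin (a + q.1) : Matrix (Fin 2) (Fin 2) ℂ) 1 q.2
      else 0 := by
    ext i ⟨k, j⟩
    have h1 := k.2
    have h2 : n ≠ (k : ℕ) := by omega
    have h3 : ¬ ((k : ℕ) = n + 1) := by omega
    have h4 : ¬ (Fin.last n = k.castSucc) := (Fin.castSucc_lt_last k).ne'
    fin_cases i <;>
    simp [X, reflected, truncWalk, reflector, Matrix.toBlocks₂₁, Matrix.scalar_apply,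
      Matrix.diagonal_apply, h2.symm, h3, h4]
  have hA : X.toBlocks₁₁ = truncWalk coin a n - Matrix.scalar _ μ := by
    ext ⟨k, i⟩ ⟨l, j⟩
    have h1 := k.2
    have h2 : (k : ℕ) ≠ n := by omega
    simp [X, reflected, truncWalk, reflector, Matrix.toBlocks₁₁, Matrix.scalar_apply,
      Matrix.diagonal_apply, h2]
  let Di : Matrix (Fin 2) (Fin 2) ℂ := !![-p⁻¹, -(ρ * c 1 1 / (p * μ)); 0, -μ⁻¹]
  have hDi : X.toBlocks₂₂ * Di = 1 := by
    rw [hD]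
    ext i j
    fin_cases i <;> fin_cases j <;> simp [Di, Matrix.mul_apply, hμ, hρ]
    field_simp
    ring
  let _ : Invertible X.toBlocks₂₂ := ⟨Di, mul_eq_one_comm.1 hDi, hDi⟩
  have hinv : ⅟X.toBlocks₂₂ = Di := invOf_eq_right_inv hDi
  rw [← Matrix.fromBlocks_toBlocks X, Matrix.det_fromBlocks₂₂, hinv]
  congr 1
  · rw [hD]; simp; ring
  · congr 1
    rw [hA, hB, hC, reflected, sub_eq_add_neg]
    congr 1
    ext ⟨k, i⟩ ⟨l, j⟩
    by_cases hk : (k : ℕ) + 1 = n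
    · by_cases hl : (l : ℕ) + 1 = n
      · fin_cases i <;> simp [reflector, Matrix.mul_apply, Di, hk, hl]
        rw [← neg_mul]
        congr 1
        rw [Matrix.det_fin_two]
        field_simp
        rw [hp]
        ring
      · simp [reflector, Matrix.mul_apply, hl]
    · simp [reflector, Matrix.mul_apply, hk]

theorem continuous_det_reflected (coin : Coin) (a : ℤ) (n : ℕ) (μ : ℂ) :
    Continuous fun ρ => (reflected coin a n μ ρ).det := by
  unfold reflected
  fun_prop

/-- At most one `ρ` is excluded. Identities proved where the Schur complement exists then extend to
all `ρ` by continuity. -/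
theorem dense_ne_mul {μ : ℂ} (hμ : μ ≠ 0) (z : ℂ) : Dense {ρ : ℂ | μ - ρ * z ≠ 0} := by
  refine (dense_compl_singleton (μ / z)).mono fun ρ hρ => ?_
  intro h
  refine hρ ?_
  have hz : z ≠ 0 := by rintro rfl; simp [hμ] at h
  rw [Set.mem_singleton_iff, eq_div_iff hz]
  linear_combination -h

/-- The last factor vanishes exactly when the solution with left amplitudes `(1, 0)` meets the
mirror condition `ψ^L(a + n - 1) = ρ ψ^R(a + n)`. -/
theorem det_reflected {coin : Coin} (h : Admissible coin) (a : ℤ) (n : ℕ) {μ : ℂ} (hμ : μ ≠ 0)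
    (ρ : ℂ) : (reflected coin a n μ ρ).det =
      (∏ k ∈ Finset.range n, (coin (a + k) : Matrix (Fin 2) (Fin 2) ℂ) 0 0) * μ ^ (2 * n) *
        (amp coin a μ n 0 0 - ρ * μ ^ (1 - 2 * (a + n)) * amp coin a μ n 1 0) := by
  induction n generalizing ρ with
  | zero => simp [amp]
  | succ n ih =>
    have hcont : Continuous fun ρ : ℂ =>
        (∏ k ∈ Finset.range (n + 1), (coin (a + k) : Matrix (Fin 2) (Fin 2) ℂ) 0 0) *
          μ ^ (2 * (n + 1)) * (amp coin a μ (n + 1) 0 0 -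
            ρ * μ ^ (1 - 2 * (a + (n + 1 : ℕ))) * amp coin a μ (n + 1) 1 0) := by fun_prop
    -- The elimination needs `μ ≠ ρ c₂₁`; both sides are continuous in `ρ`, so a dense set is
    -- enough.
    refine congrFun (Continuous.ext_on (dense_ne_mul hμ
      ((coin (a + n) : Matrix (Fin 2) (Fin 2) ℂ) 1 0)) (continuous_det_reflected coin a _ μ)
      hcont fun ρ hρ => ?_) ρ
    rw [det_reflected_succ hμ rfl hρ, ih, Finset.prod_range_succ, amp]
    have h0 := h.diag_ne_zero (a + n) 0
    generalize hc : (coin (a + n) : Matrix (Fin 2) (Fin 2) ℂ) = c at hρ h0 ⊢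
    have hz : μ ^ (a + n) ≠ 0 := zpow_ne_zero _ hμ
    have e1 : μ ^ (1 - 2 * (a + n) : ℤ) = μ * (μ ^ (a + n : ℤ))⁻¹ ^ 2 := by
      rw [zpow_sub₀ hμ, ← zpow_neg, ← zpow_natCast, ← zpow_mul, zpow_one, div_eq_mul_inv,
        ← zpow_neg]
      congr 2; push_cast; ring
    have e2 : μ ^ (1 - 2 * (a + (n + 1 : ℕ)) : ℤ) = μ⁻¹ * (μ ^ (a + n : ℤ))⁻¹ ^ 2 := by
      rw [← zpow_neg, ← zpow_natCast, ← zpow_mul, ← zpow_neg_one, ← zpow_add₀ hμ]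
      congr 1; push_cast; ring
    have e3 : μ ^ (-2 * (a + n) : ℤ) = (μ ^ (a + n : ℤ))⁻¹ ^ 2 := by
      rw [← zpow_neg, ← zpow_natCast, ← zpow_mul]; congr 1; push_cast; ring
    have e4 : μ ^ (2 * (a + n) : ℤ) = (μ ^ (a + n : ℤ)) ^ 2 := by
      rw [← zpow_natCast, ← zpow_mul]; congr 1; push_cast; ring
    simp only [ampSite, hc, Matrix.mul_apply, Fin.sum_univ_two, Matrix.smul_apply,
      Matrix.of_apply, Matrix.cons_val', Matrix.cons_val_zero, Matrix.cons_val_one,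
      Matrix.cons_val_fin_one, smul_eq_mul, e1, e2, e3, e4]
    generalize μ ^ (a + n : ℤ) = z at hz
    generalize amp coin a μ n 0 0 = m1
    generalize amp coin a μ n 1 0 = m2
    have hρ' : μ - ρ * c 1 0 ≠ 0 := hρ
    rw [mul_add 2 n 1, pow_add]
    generalize c.det = d
    field_simp
    ring

theorem det_truncWalk_sub {coin : Coin} (h : Admissible coin) (a : ℤ) (n : ℕ) {μ : ℂ}
    (hμ : μ ≠ 0) : (truncWalk coin a n - Matrix.scalar _ μ).det =
      (∏ k ∈ Finset.range n, (coin (a + k) : Matrix (Fin 2) (Fin 2) ℂ) 0 0) * μ ^ (2 * n) *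
        amp coin a μ n 0 0 := by
  simpa [reflected] using det_reflected h a n hμ 0

theorem eval_charpoly_truncWalk {coin : Coin} (h : Admissible coin) (a : ℤ) (n : ℕ) {μ : ℂ}
    (hμ : μ ≠ 0) : (truncWalk coin a n).charpoly.eval μ =
      (∏ k ∈ Finset.range n, (coin (a + k) : Matrix (Fin 2) (Fin 2) ℂ) 0 0) * μ ^ (2 * n) *
        amp coin a μ n 0 0 := by
  rw [Matrix.eval_charpoly, ← det_truncWalk_sub h a n hμ, ← neg_sub, Matrix.det_neg]
  simp [pow_mul']

/-! ### The cut-off resolvent -/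

theorem norm_sq_eq_tsum (ψ : Hilb) : ‖ψ‖ ^ 2 = ∑' x, ‖ψ x‖ ^ 2 := by
  have := lp.norm_rpow_eq_tsum (p := 2) (by norm_num) ψ
  simpa using this

/-- The coin is isometric at each site and the shift only translates the two components, so the sum
of squares splits by component and is reindexed. -/
theorem norm_evolution_apply_le (coin : Coin) (ψ : Hilb) : ‖evolution coin ψ‖ ≤ ‖ψ‖ := by
  have hsum : ∀ i : Fin 2, Summable fun x : ℤ => ‖coinAct coin ψ x i‖ ^ 2 := fun i =>
    Summable.of_nonneg_of_le (fun _ => by positivity)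
      (fun x => by
        rw [← norm_coin coin x (ψ x)]
        have := PiLp.norm_apply_le (coinAct coin ψ x) i
        exact pow_le_pow_left₀ (norm_nonneg _) this 2) (summable_sq ψ)
  have e : ∀ x, ‖evolution coin ψ x‖ ^ 2 =
      ‖coinAct coin ψ (Equiv.addRight 1 x) 0‖ ^ 2 +
        ‖coinAct coin ψ (Equiv.subRight 1 x) 1‖ ^ 2 := fun x => by
    simp [walk, shiftAct, EuclideanSpace.norm_sq_eq, Fin.sum_univ_two]
  have h0 := ((Equiv.addRight (1 : ℤ)).summable_iff (f := fun x => ‖coinAct coin ψ x 0‖ ^ 2)).2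
    (hsum 0)
  have h1 := ((Equiv.subRight (1 : ℤ)).summable_iff (f := fun x => ‖coinAct coin ψ x 1‖ ^ 2)).2
    (hsum 1)
  have key : ‖evolution coin ψ‖ ^ 2 = ‖ψ‖ ^ 2 := by
    rw [norm_sq_eq_tsum, norm_sq_eq_tsum, tsum_congr e]
    refine (Summable.tsum_add h0 h1).trans ?_
    simp only [Function.comp_def]
    rw [(Equiv.addRight (1 : ℤ)).tsum_eq (fun x => ‖coinAct coin ψ x 0‖ ^ 2),
      (Equiv.subRight (1 : ℤ)).tsum_eq (fun x => ‖coinAct coin ψ x 1‖ ^ 2),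
      ← Summable.tsum_add (hsum 0) (hsum 1)]
    refine tsum_congr fun x => ?_
    rw [← norm_coin coin x (ψ x), EuclideanSpace.norm_sq_eq, Fin.sum_univ_two]
    rfl
  exact (sq_eq_sq₀ (norm_nonneg _) (norm_nonneg _)).1 key |>.le

theorem isUnit_evolution_sub (coin : Coin) {μ : ℂ} (hμ : 1 < ‖μ‖) :
    IsUnit (evolution coin - μ • 1) := by
  have h0 : μ ≠ 0 := by rintro rfl; simp at hμ; linarith
  have h1 : ‖evolution coin‖ ≤ 1 :=
    ContinuousLinearMap.opNorm_le_bound _ zero_le_one fun ψ => by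
      simpa using norm_evolution_apply_le coin ψ
  have h2 : ‖μ⁻¹ • evolution coin‖ < 1 := by
    rw [norm_smul, norm_inv]
    calc ‖μ‖⁻¹ * ‖evolution coin‖ ≤ ‖μ‖⁻¹ * 1 := by gcongr
      _ < 1 := by rw [mul_one]; exact inv_lt_one_of_one_lt₀ hμ
  have h3 := (isUnit_one_sub_of_norm_lt_one h2).neg
  have h4 : evolution coin - μ • 1 = (Units.mk0 μ h0) • -(1 - μ⁻¹ • evolution coin) := by
    rw [Units.smul_def, Units.val_mk0, smul_neg, smul_sub, smul_smul, mul_inv_cancel₀ h0, one_smul]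
    abel
  rw [h4]
  exact h3.smul _

/-- `J` meets the integers exactly in `{a, …, a + n - 1}`. -/
def MeetsIn (J : Set ℝ) (a : ℤ) (n : ℕ) : Prop := ∀ x : ℤ, (x : ℝ) ∈ J ↔ a ≤ x ∧ x < a + n

theorem exists_meetsIn {J : Set ℝ} (h1 : J.OrdConnected) (h2 : Bornology.IsBounded J) :
    ∃ a n, MeetsIn J a n := by
  rcases Set.eq_empty_or_nonempty {x : ℤ | (x : ℝ) ∈ J} with h | h
  -- The interval may contain no integer; the window is then empty.
  · refine ⟨0, 0, fun x => ?_⟩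
    have : x ∉ {x : ℤ | (x : ℝ) ∈ J} := by simp [h]
    have : (x : ℝ) ∉ J := this
    simp only [this, false_iff]
    push_cast
    omega
  · have hb : BddBelow {x : ℤ | (x : ℝ) ∈ J} := by
      obtain ⟨r, hr⟩ := h2.bddBelow
      exact ⟨⌊r⌋, fun x hx => by exact_mod_cast (Int.floor_le r).trans (hr hx)⟩
    have ha : BddAbove {x : ℤ | (x : ℝ) ∈ J} := by
      obtain ⟨r, hr⟩ := h2.bddAbove
      exact ⟨⌈r⌉, fun x hx => by exact_mod_cast (hr hx).trans (Int.le_ceil r)⟩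
    have m1 := Int.csInf_mem h hb
    have m2 := Int.csSup_mem h ha
    refine ⟨sInf {x : ℤ | (x : ℝ) ∈ J},
      (sSup {x : ℤ | (x : ℝ) ∈ J} - sInf {x : ℤ | (x : ℝ) ∈ J} + 1).toNat, fun x => ?_⟩
    constructor
    · intro hx
      have l1 := csInf_le hb hx
      have l2 := le_csSup ha hx
      omega
    · rintro ⟨l1, l2⟩
      exact h1.out m1 m2 ⟨by exact_mod_cast l1, by
        have : x ≤ sSup {x : ℤ | (x : ℝ) ∈ J} := by omega
        exact_mod_cast this⟩

theorem IsWindow.supportedIn {coin : Coin} {J : Set ℝ} (hJ : IsWindow coin J) {a : ℤ} {n : ℕ}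
    (h : MeetsIn J a n) : SupportedIn coin a n := by
  intro x hx
  by_contra hc
  have := (h x).1 (hJ.2.2 (subset_convexHull ℝ _ ⟨x, hc, rfl⟩))
  omega

/-- The coordinates of a state on the sites `a, …, a + n - 1`. -/
def restrictSites (a : ℤ) (n : ℕ) (ψ : ℤ → Spin) : Fin n × Fin 2 → ℂ := fun p => ψ (a + p.1) p.2

/-- The basis vector at `p`. -/
def siteVec (a : ℤ) (n : ℕ) (p : Fin n × Fin 2) : Hilb :=
  lp.single 2 (a + p.1 : ℤ) (EuclideanSpace.single p.2 (1 : ℂ))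

/-- The coordinate functional at `p`. -/
def siteCoord (a : ℤ) (n : ℕ) (p : Fin n × Fin 2) : Hilb →L[ℂ] ℂ :=
  (EuclideanSpace.proj p.2).comp (lp.evalCLM ℂ (fun _ : ℤ => Spin) 2 (a + p.1 : ℤ))

@[simp] theorem siteCoord_apply (a : ℤ) (n : ℕ) (p : Fin n × Fin 2) (ψ : Hilb) :
    siteCoord a n p ψ = ψ (a + p.1) p.2 := rfl

/-- The state on `a, …, a + n - 1` with given coordinates. -/
def extendSites (a : ℤ) (n : ℕ) : (Fin n × Fin 2 → ℂ) →ₗ[ℂ] Hilb where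
  toFun v := ∑ p, v p • siteVec a n p
  map_add' v w := by simp [add_smul, Finset.sum_add_distrib]
  map_smul' c v := by simp [mul_smul, Finset.smul_sum]

/-- The operator on `ℓ²(ℤ; ℂ²)` given by a matrix on the sites `a, …, a + n - 1`. -/
def siteOperator (a : ℤ) (n : ℕ) (A : Matrix (Fin n × Fin 2) (Fin n × Fin 2) ℂ) :
    Hilb →L[ℂ] Hilb :=
  ∑ p, ∑ q, A p q • (siteCoord a n q).smulRight (siteVec a n p)

theorem siteOperator_apply (a : ℤ) (n : ℕ) (A : Matrix (Fin n × Fin 2) (Fin n × Fin 2) ℂ)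
    (ψ : Hilb) : siteOperator a n A ψ = extendSites a n (A.mulVec (restrictSites a n ψ)) := by
  simp [siteOperator, extendSites, Matrix.mulVec, dotProduct, restrictSites, Finset.sum_smul,
    smul_smul]

theorem siteVec_apply (a : ℤ) (n : ℕ) (p : Fin n × Fin 2) (x : ℤ) (i : Fin 2) :
    siteVec a n p x i = if x = a + p.1 ∧ i = p.2 then 1 else 0 := by
  by_cases hx : x = a + p.1
  · subst hx
    simp [siteVec]
  · simp [siteVec, hx]

theorem extendSites_apply (a : ℤ) (n : ℕ) (v : Fin n × Fin 2 → ℂ) (x : ℤ) (i : Fin 2) :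
    extendSites a n v x i = ∑ p, v p * (if x = a + p.1 ∧ i = p.2 then 1 else 0) := by
  simp only [extendSites, LinearMap.coe_mk, AddHom.coe_mk, lp.coeFn_sum, Finset.sum_apply,
    WithLp.ofLp_sum, lp.coeFn_smul, Pi.smul_apply, WithLp.ofLp_smul, siteVec_apply, smul_eq_mul]

theorem restrictSites_extendSites (a : ℤ) (n : ℕ) (v : Fin n × Fin 2 → ℂ) :
    restrictSites a n (extendSites a n v) = v := by
  ext ⟨k, i⟩
  rw [restrictSites, extendSites_apply, Finset.sum_eq_single (k, i)]
  · simp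
  · rintro ⟨l, j⟩ - hne
    have : ¬ (a + (k : ℤ) = a + (l : ℤ) ∧ i = j) := by
      rintro ⟨h1, rfl⟩
      exact hne (by simp only [Prod.mk.injEq, and_true]; omega)
    simp only [this, if_false, mul_zero]
  · simp

theorem extendSites_restrictSites {J : Set ℝ} {a : ℤ} {n : ℕ} (hJ : MeetsIn J a n) (ψ : Hilb) :
    extendSites a n (restrictSites a n ψ) = cutoff J ψ := by
  ext x i
  rw [extendSites_apply, cutoff_apply]
  by_cases hx : (x : ℝ) ∈ J
  · have hx' := (hJ x).1 hx
    obtain ⟨k, rfl⟩ : ∃ k : Fin n, a + (k : ℤ) = x :=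
      ⟨⟨(x - a).toNat, by omega⟩, by simp; omega⟩
    have := congrFun (restrictSites_extendSites a n (restrictSites a n ψ)) (k, i)
    rw [restrictSites, extendSites_apply] at this
    rw [this]
    simp only [restrictSites, cutoffAct, LinearMap.coe_mk, AddHom.coe_mk, hx, if_true]
  · simp only [cutoffAct, LinearMap.coe_mk, AddHom.coe_mk, hx, if_false, PiLp.zero_apply]
    refine Finset.sum_eq_zero fun p _ => ?_
    have : ¬ (x = a + (p.1 : ℤ) ∧ i = p.2) := by
      rintro ⟨h1, -⟩
      exact hx ((hJ x).2 (by omega))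
    simp [this]

theorem restrictSites_cutoff {J : Set ℝ} {a : ℤ} {n : ℕ} (hJ : MeetsIn J a n) (ψ : Hilb) :
    restrictSites a n (cutoff J ψ) = restrictSites a n ψ := by
  rw [← extendSites_restrictSites hJ, restrictSites_extendSites]

theorem walk_apply_zero (coin : Coin) (ψ : ℤ → Spin) (x : ℤ) :
    walk coin ψ x 0 = (coin (x + 1) : Matrix (Fin 2) (Fin 2) ℂ) 0 0 * ψ (x + 1) 0 +
      (coin (x + 1) : Matrix (Fin 2) (Fin 2) ℂ) 0 1 * ψ (x + 1) 1 := by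
  simp [walk, shiftAct, coinAct, Matrix.toLpLin_apply, Matrix.mulVec, dotProduct]

theorem walk_apply_one (coin : Coin) (ψ : ℤ → Spin) (x : ℤ) :
    walk coin ψ x 1 = (coin (x - 1) : Matrix (Fin 2) (Fin 2) ℂ) 1 0 * ψ (x - 1) 0 +
      (coin (x - 1) : Matrix (Fin 2) (Fin 2) ℂ) 1 1 * ψ (x - 1) 1 := by
  simp [walk, shiftAct, coinAct, Matrix.toLpLin_apply, Matrix.mulVec, dotProduct]

/-- On states without incoming waves the walk acts inside the window as the truncated walk. -/
theorem truncWalk_mulVec {coin : Coin} {a : ℤ} {n : ℕ} (hs : SupportedIn coin a n)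
    {ψ : ℤ → Spin} (hR : ψ (a + n) 0 = 0) (hL : ψ (a - 1) 1 = 0) :
    (truncWalk coin a n).mulVec (restrictSites a n ψ) = restrictSites a n (walk coin ψ) := by
  ext ⟨k, i⟩
  simp only [Matrix.mulVec, dotProduct, Fintype.sum_prod_type, truncWalk, Matrix.of_apply,
    restrictSites, Fin.sum_univ_two]
  fin_cases i
  · simp only [Fin.zero_eta, if_true, walk_apply_zero]
    by_cases hk : (k : ℕ) + 1 < n
    · rw [Finset.sum_eq_single ⟨k + 1, hk⟩]
      · simp [add_assoc]
      · intro l _ hl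
        have : (l : ℕ) ≠ k + 1 := fun h => hl (Fin.ext h)
        simp [this]
      · simp
    · have e : a + (k : ℤ) + 1 = a + n := by omega
      rw [e, hR, hs _ (Or.inr le_rfl), Finset.sum_eq_zero]
      · simp
      · intro l _
        have : (l : ℕ) ≠ k + 1 := by omega
        simp [this]
  · simp only [Fin.mk_one, one_ne_zero, if_false, walk_apply_one]
    by_cases hk : 0 < (k : ℕ)
    · rw [Finset.sum_eq_single ⟨k - 1, by omega⟩]
      · have e : a + (k : ℤ) - 1 = a + ((k - 1 : ℕ) : ℤ) := by omega
        have e2 : (k : ℕ) - 1 + 1 = k := by omega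
        simp [e, e2]
      · intro l _ hl
        have : (l : ℕ) + 1 ≠ k := fun h => hl (Fin.ext (by simp; omega))
        simp [this]
      · simp
    · have e : a + (k : ℤ) - 1 = a - 1 := by omega
      rw [e, hL, hs _ (Or.inl (by omega)), Finset.sum_eq_zero]
      · simp
      · intro l _
        have : (l : ℕ) + 1 ≠ k := by omega
        simp [this]

/-- A bounded geometric sequence with ratio of modulus greater than one vanishes. -/
theorem eq_zero_of_bounded_geometric {μ z : ℂ} (hμ : 1 < ‖μ‖) {C : ℝ}
    (h : ∀ k : ℕ, ‖μ ^ k * z‖ ≤ C) : z = 0 := by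
  by_contra hz
  have hz' : 0 < ‖z‖ := norm_pos_iff.2 hz
  obtain ⟨k, hk⟩ := pow_unbounded_of_one_lt (C / ‖z‖) hμ
  have := h k
  rw [norm_mul, norm_pow] at this
  rw [div_lt_iff₀ hz'] at hk
  linarith

theorem norm_coord_le (ψ : Hilb) (x : ℤ) (i : Fin 2) : ‖ψ x i‖ ≤ ‖ψ‖ :=
  (PiLp.norm_apply_le (ψ x) i).trans (lp.norm_apply_le_norm (by norm_num) ψ x)

/-- Confines the eigenvalues of the truncated walk to the open unit disc. -/
theorem det_truncWalk_sub_ne_zero {coin : Coin} (h : Admissible coin) {a : ℤ} {n : ℕ}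
    (hs : SupportedIn coin a n) {μ : ℂ} (hμ : 1 ≤ ‖μ‖) :
    (truncWalk coin a n - Matrix.scalar _ μ).det ≠ 0 := by
  have h0 : μ ≠ 0 := by rintro rfl; simp at hμ; linarith
  rw [det_truncWalk_sub h a n h0]
  exact mul_ne_zero (mul_ne_zero (Finset.prod_ne_zero_iff.2 fun k _ => h.diag_ne_zero _ 0)
    (pow_ne_zero _ h0)) (amp_zero_zero_ne_zero h hs hμ)

/-- Outside the window the resolved state satisfies the free equation, so an incoming component
would grow like `μ ^ k` away from the window. Square summability forbids this, and without incoming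
waves the equation inside closes on the truncated walk. -/
theorem cutoffResolvent_eq {coin : Coin} (h : Admissible coin) {J : Set ℝ} {a : ℤ} {n : ℕ}
    (hs : SupportedIn coin a n) (hJ : MeetsIn J a n) {μ : ℂ} (hμ : 1 < ‖μ‖) :
    cutoffResolvent coin J μ =
      siteOperator a n (truncWalk coin a n - Matrix.scalar _ μ)⁻¹ := by
  ext1 ψ
  set φ : Hilb := Ring.inverse (evolution coin - μ • 1) (cutoff J ψ) with hφ
  have eq1 : evolution coin φ - μ • φ = cutoff J ψ := by
    have := congrArg (fun T : Hilb →L[ℂ] Hilb => T (cutoff J ψ))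
      (Ring.mul_inverse_cancel _ (isUnit_evolution_sub coin hμ))
    simpa [← hφ] using this
  have eq2 : ∀ x i, walk coin φ x i - μ * φ x i = cutoff J ψ x i := fun x i => by
    rw [← eq1]; rfl
  have out : ∀ x : ℤ, (x < a ∨ a + n ≤ x) → ∀ i, walk coin φ x i = μ * φ x i := fun x hx i => by
    have hxJ : (x : ℝ) ∉ J := fun hx' => by have := (hJ x).1 hx'; omega
    have := eq2 x i
    simp only [cutoff_apply, cutoffAct, LinearMap.coe_mk, AddHom.coe_mk, hxJ, if_false,
      PiLp.zero_apply] at this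
    exact sub_eq_zero.1 this
  have hR : φ (a + n) 0 = 0 := by
    refine eq_zero_of_bounded_geometric hμ (C := ‖φ‖) fun k => ?_
    have : μ ^ k * φ (a + n) 0 = φ (a + n + k) 0 := by
      induction k with
      | zero => simp
      | succ k ih =>
        have := out (a + n + k) (Or.inr (by omega)) 0
        rw [walk_apply_zero, hs _ (Or.inr (by omega))] at this
        rw [pow_succ', mul_assoc, ih, ← this]
        simp [add_assoc]
    rw [this]
    exact norm_coord_le _ _ _
  have hL : φ (a - 1) 1 = 0 := by
    refine eq_zero_of_bounded_geometric hμ (C := ‖φ‖) fun k => ?_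
    have : μ ^ k * φ (a - 1) 1 = φ (a - 1 - k) 1 := by
      induction k with
      | zero => simp
      | succ k ih =>
        have := out (a - 1 - k) (Or.inl (by omega)) 1
        rw [walk_apply_one, hs _ (Or.inl (by omega))] at this
        rw [pow_succ', mul_assoc, ih, ← this]
        simp [sub_sub, add_assoc]
    rw [this]
    exact norm_coord_le _ _ _
  have eq3 : (truncWalk coin a n - Matrix.scalar _ μ).mulVec (restrictSites a n φ) =
      restrictSites a n ψ := by
    rw [Matrix.sub_mulVec, truncWalk_mulVec hs hR hL, ← restrictSites_cutoff hJ ψ]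
    ext p
    have := eq2 (a + p.1) p.2
    simpa [restrictSites, Matrix.scalar_apply, Matrix.mulVec_diagonal] using this
  rw [siteOperator_apply, ← eq3, Matrix.mulVec_mulVec, Matrix.nonsing_inv_mul _
    (isUnit_iff_ne_zero.2 (det_truncWalk_sub_ne_zero h hs hμ.le)), Matrix.one_mulVec,
    extendSites_restrictSites hJ]
  rfl

/-! ### Resolvents of matrices -/

section MatrixResolvent

variable {ι : Type*} [Fintype ι] [DecidableEq ι]

/-- The entries of the resolvent of a matrix are rational functions. -/
theorem exists_polynomial_inv_apply (Z : Matrix ι ι ℂ) (p q : ι) :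
    ∃ f : Polynomial ℂ, ∀ μ : ℂ, (Z - Matrix.scalar ι μ)⁻¹ p q =
      ((Z - Matrix.scalar ι μ).det)⁻¹ * f.eval μ := by
  set B : Matrix ι ι (Polynomial ℂ) := Z.map Polynomial.C - Matrix.scalar ι Polynomial.X
  have hB : ∀ μ, (Polynomial.evalRingHom μ).mapMatrix B = Z - Matrix.scalar ι μ := fun μ => by
    ext i j
    by_cases hij : i = j
    · subst hij; simp [B]
    · simp [B, hij]
  refine ⟨B.adjugate p q, fun μ => ?_⟩
  rw [Matrix.inv_def, Ring.inverse_eq_inv', ← hB, ← RingHom.map_adjugate]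
  rfl

theorem exists_polynomial_det (Z : Matrix ι ι ℂ) :
    ∃ f : Polynomial ℂ, ∀ μ : ℂ, (Z - Matrix.scalar ι μ).det = f.eval μ := by
  refine ⟨Polynomial.C ((-1) ^ Fintype.card ι) * Z.charpoly, fun μ => ?_⟩
  rw [← neg_sub, Matrix.det_neg, Polynomial.eval_mul, Matrix.eval_charpoly, Polynomial.eval_C]

theorem eval_charpoly_eq_zero_iff (Z : Matrix ι ι ℂ) (μ : ℂ) :
    Z.charpoly.eval μ = 0 ↔ (Z - Matrix.scalar ι μ).det = 0 := by
  rw [Matrix.eval_charpoly, ← neg_sub, Matrix.det_neg]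
  simp

theorem analyticAt_inv_apply (Z : Matrix ι ι ℂ) (p q : ι) {μ : ℂ}
    (hμ : (Z - Matrix.scalar ι μ).det ≠ 0) :
    AnalyticAt ℂ (fun z => (Z - Matrix.scalar ι z)⁻¹ p q) μ := by
  obtain ⟨f, hf⟩ := exists_polynomial_inv_apply Z p q
  obtain ⟨g, hg⟩ := exists_polynomial_det Z
  simp only [hf, hg] at hμ ⊢
  exact ((AnalyticOnNhd.eval_polynomial g μ trivial).inv hμ).mul
    (AnalyticOnNhd.eval_polynomial f μ trivial)

theorem meromorphicAt_inv_apply (Z : Matrix ι ι ℂ) (p q : ι) (μ : ℂ) :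
    MeromorphicAt (fun z => (Z - Matrix.scalar ι z)⁻¹ p q) μ := by
  obtain ⟨f, hf⟩ := exists_polynomial_inv_apply Z p q
  obtain ⟨g, hg⟩ := exists_polynomial_det Z
  simp only [hf, hg]
  exact (AnalyticOnNhd.eval_polynomial g μ trivial).meromorphicAt.inv.mul
    (AnalyticOnNhd.eval_polynomial f μ trivial).meromorphicAt

theorem eventually_det_sub_ne_zero (Z : Matrix ι ι ℂ) (a : ℂ) :
    ∀ᶠ μ in 𝓝[≠] a, (Z - Matrix.scalar ι μ).det ≠ 0 := by
  have hf : {μ : ℂ | Z.charpoly.eval μ = 0}.Finite :=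
    Polynomial.finite_setOfPred_isRoot (Matrix.charpoly_monic Z).ne_zero
  have : ∀ᶠ μ in 𝓝[≠] a, μ ∉ {μ : ℂ | Z.charpoly.eval μ = 0} \ {a} := by
    refine eventually_nhdsWithin_of_eventually_nhds ?_
    exact hf.sdiff.isClosed.isOpen_compl.mem_nhds (by simp)
  filter_upwards [this, self_mem_nhdsWithin] with μ h1 h2 h3
  exact h1 ⟨(eval_charpoly_eq_zero_iff Z μ).2 h3, h2⟩

/-- The resolvent on a generalized eigenvector. -/
theorem inv_mulVec_of_pow_mulVec_eq_zero (Z : Matrix ι ι ℂ) {lam μ : ℂ} (hne : μ ≠ lam)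
    (hμ : (Z - Matrix.scalar ι μ).det ≠ 0) {k : ℕ} {v : ι → ℂ}
    (hv : ((Z - Matrix.scalar ι lam) ^ k).mulVec v = 0) :
    (Z - Matrix.scalar ι μ)⁻¹.mulVec v = ∑ j ∈ Finset.range k,
      (-(μ - lam) ^ (-(j + 1 : ℕ) : ℤ)) • ((Z - Matrix.scalar ι lam) ^ j).mulVec v := by
  set N := Z - Matrix.scalar ι lam with hN
  set s := μ - lam with hs
  have hs0 : s ≠ 0 := sub_ne_zero.2 hne
  have hZ : Z - Matrix.scalar ι μ = N - s • (1 : Matrix ι ι ℂ) := by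
    rw [hN, hs, sub_smul, ← Matrix.diagonal_one, ← Matrix.diagonal_smul, ← Matrix.diagonal_smul]
    ext i j
    by_cases hij : i = j
    · subst hij; simp
    · simp [hij]
  have key : (Z - Matrix.scalar ι μ).mulVec (∑ j ∈ Finset.range k,
      (-s ^ (-(j + 1 : ℕ) : ℤ)) • (N ^ j).mulVec v) = v := by
    -- With `Z - μ = N - s`, each term becomes a difference, so the sum telescopes to `v - s⁻ᵏ Nᵏ v
    -- = v`.
    have e : ∀ j : ℕ, (Z - Matrix.scalar ι μ).mulVec
        ((-s ^ (-(j + 1 : ℕ) : ℤ)) • (N ^ j).mulVec v) =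
        (s ^ (-(j : ℕ) : ℤ)) • (N ^ j).mulVec v -
          (s ^ (-(j + 1 : ℕ) : ℤ)) • (N ^ (j + 1)).mulVec v := by
      intro j
      have e1 : s ^ (-(j : ℕ) : ℤ) = s ^ (-(j + 1 : ℕ) : ℤ) * s := by
        rw [← zpow_add_one₀ hs0]; congr 1; push_cast; ring
      rw [Matrix.mulVec_smul, hZ, Matrix.sub_mulVec, Matrix.smul_mulVec, Matrix.one_mulVec,
        Matrix.mulVec_mulVec, ← pow_succ', e1]
      module
    rw [Matrix.mulVec_sum, Finset.sum_congr rfl fun j _ => e j, Finset.sum_range_sub', hv]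
    simp
  conv_lhs => rw [← key]
  rw [Matrix.mulVec_mulVec, Matrix.nonsing_inv_mul _ (isUnit_iff_ne_zero.2 hμ), Matrix.one_mulVec]

theorem mem_maxGenEigenspace_iff (Z : Matrix ι ι ℂ) (lam : ℂ) (v : ι → ℂ) :
    v ∈ Module.End.maxGenEigenspace (Matrix.toLin' Z) lam ↔
      ∃ k : ℕ, ((Z - Matrix.scalar ι lam) ^ k).mulVec v = 0 := by
  rw [Module.End.mem_maxGenEigenspace]
  refine exists_congr fun k => ?_
  have : Matrix.toLin' Z - lam • 1 = Matrix.toLin' (Z - Matrix.scalar ι lam) := by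
    rw [map_sub]
    congr 1
    ext v
    simp [Matrix.scalar_apply, Pi.single_apply]
  rw [this, ← Matrix.toLin'_pow, Matrix.toLin'_apply]

/-- The entrywise contour integral of the resolvent. -/
def contourMatrix (Z : Matrix ι ι ℂ) (a : ℂ) (r : ℝ) : Matrix ι ι ℂ :=
  Matrix.of fun p q => circleIntegral (fun μ => (Z - Matrix.scalar ι μ)⁻¹ p q) a r

/-- On a generalized eigenvector the integral reduces to scalar integrals of powers of `μ - lam`.
Keeping `lam` apart from the centre `a` covers both the enclosed eigenvalue and all others. -/
theorem contourMatrix_mulVec (Z : Matrix ι ι ℂ) {a : ℂ} {r : ℝ} (hr : 0 < r)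
    (h : ∀ μ ∈ Metric.closedBall a r, μ ≠ a → (Z - Matrix.scalar ι μ).det ≠ 0)
    {lam : ℂ} {k : ℕ} {v : ι → ℂ} (hlam : ∀ μ ∈ Metric.sphere a r, μ ≠ lam)
    (hv : ((Z - Matrix.scalar ι lam) ^ k).mulVec v = 0) :
    (contourMatrix Z a r).mulVec v = ∑ j ∈ Finset.range k,
      (-circleIntegral (fun μ => (μ - lam) ^ (-(j + 1 : ℕ) : ℤ)) a r) •
        ((Z - Matrix.scalar ι lam) ^ j).mulVec v := by
  ext p
  simp only [Matrix.mulVec, dotProduct, contourMatrix, Matrix.of_apply]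
  have e1 : ∑ q, circleIntegral (fun μ => (Z - Matrix.scalar ι μ)⁻¹ p q) a r * v q =
      circleIntegral (fun μ => ∑ q, (Z - Matrix.scalar ι μ)⁻¹ p q * v q) a r := by
    rw [circleIntegral.integral_fun_sum fun q _ => ?_]
    · refine Finset.sum_congr rfl fun q _ => ?_
      exact (circleIntegral.integral_smul_const (fun μ => (Z - Matrix.scalar ι μ)⁻¹ p q)
        (v q) a r).symm
    · refine ContinuousOn.circleIntegrable hr.le fun μ hμ => ?_
      exact (analyticAt_inv_apply Z p q (h μ (Metric.sphere_subset_closedBall hμ)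
        (Metric.ne_of_mem_sphere hμ hr.ne'))).continuousAt.continuousWithinAt.mul
        continuousWithinAt_const
  rw [e1]
  have e2 : circleIntegral (fun μ => ∑ q, (Z - Matrix.scalar ι μ)⁻¹ p q * v q) a r =
      circleIntegral (fun μ => ∑ j ∈ Finset.range k, (μ - lam) ^ (-(j + 1 : ℕ) : ℤ) *
        (-((Z - Matrix.scalar ι lam) ^ j).mulVec v p)) a r := by
    refine circleIntegral.integral_congr hr.le fun μ hμ => ?_
    have := congrFun (inv_mulVec_of_pow_mulVec_eq_zero Z (hlam μ hμ)
      (h μ (Metric.sphere_subset_closedBall hμ) (Metric.ne_of_mem_sphere hμ hr.ne')) hv) p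
    simp only [Matrix.mulVec, dotProduct, Finset.sum_apply, Pi.smul_apply, smul_eq_mul] at this ⊢
    rw [this]
    exact Finset.sum_congr rfl fun j _ => by ring
  rw [e2, circleIntegral.integral_fun_sum fun j _ => ?_]
  · simp only [Finset.sum_apply, Pi.smul_apply, smul_eq_mul]
    refine Finset.sum_congr rfl fun j _ => ?_
    rw [show (fun z : ℂ => (z - lam) ^ (-(j + 1 : ℕ) : ℤ) *
      -((Z - Matrix.scalar ι lam) ^ j).mulVec v p) = fun z =>
        (z - lam) ^ (-(j + 1 : ℕ) : ℤ) • -((Z - Matrix.scalar ι lam) ^ j).mulVec v p from rfl,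
      circleIntegral.integral_smul_const]
    simp [Matrix.mulVec, dotProduct]
  · refine ContinuousOn.circleIntegrable hr.le fun μ hμ => ?_
    refine ContinuousAt.continuousWithinAt (ContinuousAt.mul ?_ continuousAt_const)
    exact (continuousAt_id.sub continuousAt_const).zpow₀ _
      (Or.inl (sub_ne_zero.2 (hlam μ hμ)))

theorem contourMatrix_mulVec_self (Z : Matrix ι ι ℂ) {a : ℂ} {r : ℝ} (hr : 0 < r)
    (h : ∀ μ ∈ Metric.closedBall a r, μ ≠ a → (Z - Matrix.scalar ι μ).det ≠ 0)
    {v : ι → ℂ} (hv : v ∈ Module.End.maxGenEigenspace (Matrix.toLin' Z) a) :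
    (contourMatrix Z a r).mulVec v = (-(2 * Real.pi * Complex.I) : ℂ) • v := by
  obtain ⟨k, hk⟩ := (mem_maxGenEigenspace_iff Z a v).1 hv
  -- The exponent is raised by one so that the term `j = 0`, the only one with a residue, is always
  -- present.
  have hk' : ((Z - Matrix.scalar ι a) ^ (k + 1)).mulVec v = 0 := by
    rw [pow_succ', ← Matrix.mulVec_mulVec, hk, Matrix.mulVec_zero]
  rw [contourMatrix_mulVec Z hr h (fun μ hμ => Metric.ne_of_mem_sphere hμ hr.ne') hk',
    Finset.sum_eq_single 0]
  · have := circleIntegral.integral_sub_center_inv a hr.ne'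
    simp only [zero_add, Nat.cast_one, zpow_neg, zpow_one, pow_zero, Matrix.one_mulVec, this]
  · intro j _ hj
    rw [circleIntegral.integral_sub_zpow_of_ne (by omega)]
    simp
  · simp

/-- If `lam` lies in the disc, `Z - lam` is invertible and `v = 0`; otherwise all integrands are
holomorphic on the disc. -/
theorem contourMatrix_mulVec_of_ne (Z : Matrix ι ι ℂ) {a : ℂ} {r : ℝ} (hr : 0 < r)
    (h : ∀ μ ∈ Metric.closedBall a r, μ ≠ a → (Z - Matrix.scalar ι μ).det ≠ 0)
    {lam : ℂ} (hlam : lam ≠ a)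
    {v : ι → ℂ} (hv : v ∈ Module.End.maxGenEigenspace (Matrix.toLin' Z) lam) :
    (contourMatrix Z a r).mulVec v = 0 := by
  obtain ⟨k, hk⟩ := (mem_maxGenEigenspace_iff Z lam v).1 hv
  by_cases hl : lam ∈ Metric.closedBall a r
  · have hu : IsUnit ((Z - Matrix.scalar ι lam) ^ k).det := by
      rw [Matrix.det_pow]
      exact (isUnit_iff_ne_zero.2 (h lam hl hlam)).pow k
    have : v = 0 := by
      have := congrArg (((Z - Matrix.scalar ι lam) ^ k)⁻¹.mulVec) hk
      rwa [Matrix.mulVec_mulVec, Matrix.nonsing_inv_mul _ hu, Matrix.one_mulVec,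
        Matrix.mulVec_zero] at this
    rw [this, Matrix.mulVec_zero]
  · have hne : ∀ μ ∈ Metric.closedBall a r, μ ≠ lam := by
      rintro μ hμ rfl
      exact hl hμ
    rw [contourMatrix_mulVec Z hr h
      (fun μ hμ => hne μ (Metric.sphere_subset_closedBall hμ)) hk]
    refine Finset.sum_eq_zero fun j _ => ?_
    rw [DiffContOnCl.circleIntegral_eq_zero hr.le, neg_zero, zero_smul]
    refine DifferentiableOn.diffContOnCl fun μ hμ => ?_
    rw [closure_ball _ hr.ne'] at hμ
    have hd : DifferentiableAt ℂ (fun z => z - lam) μ := by fun_prop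
    exact (hd.zpow (Or.inl (sub_ne_zero.2 (hne μ hμ)))).differentiableWithinAt

/-- Generalized eigenspaces span over `ℂ`. The integral acts as `-2πi` on the one at `a` and kills
the rest. -/
theorem range_contourMatrix (Z : Matrix ι ι ℂ) {a : ℂ} {r : ℝ} (hr : 0 < r)
    (h : ∀ μ ∈ Metric.closedBall a r, μ ≠ a → (Z - Matrix.scalar ι μ).det ≠ 0) :
    (Matrix.toLin' (contourMatrix Z a r)).range = Module.End.maxGenEigenspace (Matrix.toLin' Z) a := by
  apply le_antisymm
  · rintro _ ⟨v, rfl⟩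
    have hv : v ∈ ⨆ lam, Module.End.maxGenEigenspace (Matrix.toLin' Z) lam := by
      rw [Module.End.iSup_maxGenEigenspace_eq_top]
      trivial
    refine Submodule.iSup_induction _ (motive := fun v => Matrix.toLin' (contourMatrix Z a r) v ∈
      Module.End.maxGenEigenspace (Matrix.toLin' Z) a) hv (fun lam v hv => ?_) ?_
      fun v w hv hw => ?_
    · by_cases hl : lam = a
      · subst hl
        rw [Matrix.toLin'_apply, contourMatrix_mulVec_self Z hr h hv]
        exact Submodule.smul_mem _ _ hv
      · rw [Matrix.toLin'_apply, contourMatrix_mulVec_of_ne Z hr h hl hv]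
        exact Submodule.zero_mem _
    · rw [map_zero]
      exact Submodule.zero_mem _
    · rw [map_add]
      exact Submodule.add_mem _ hv hw
  · intro v hv
    refine ⟨(-(2 * Real.pi * Complex.I) : ℂ)⁻¹ • v, ?_⟩
    rw [map_smul, Matrix.toLin'_apply, contourMatrix_mulVec_self Z hr h hv,
      inv_smul_smul₀ (neg_ne_zero.2 Complex.two_pi_I_ne_zero)]

theorem finrank_range_contourMatrix (Z : Matrix ι ι ℂ) {a : ℂ} {r : ℝ} (hr : 0 < r)
    (h : ∀ μ ∈ Metric.closedBall a r, μ ≠ a → (Z - Matrix.scalar ι μ).det ≠ 0) :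
    Module.finrank ℂ (Matrix.toLin' (contourMatrix Z a r)).range =
      Z.charpoly.rootMultiplicity a := by
  rw [range_contourMatrix Z hr h, LinearMap.finrank_maxGenEigenspace_eq, Matrix.charpoly_toLin']

end MatrixResolvent

/-! ### Punctured neighbourhoods and meromorphic continuation -/

theorem eventually_closedBall_of_eventually_nhdsNE {a : ℂ} {P : ℂ → Prop}
    (h : ∀ᶠ z in 𝓝[≠] a, P z) :
    ∀ᶠ r : ℝ in 𝓝[>] 0, 0 < r ∧ ∀ z ∈ Metric.closedBall a r, z ≠ a → P z := by
  rw [eventually_nhdsWithin_iff, Metric.eventually_nhds_iff_ball] at h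
  obtain ⟨ε, hε, h⟩ := h
  filter_upwards [Ioo_mem_nhdsGT hε] with r hr
  exact ⟨hr.1, fun z hz hne => h z (Metric.closedBall_subset_ball hr.2 hz) hne⟩

/-- Identity theorem: infinite order of `f - g` at one point spreads over the connected plane.
Values at poles are arbitrary, hence the punctured neighbourhoods. -/
theorem eventuallyEq_of_frequently_eq {E : Type*} [NormedAddCommGroup E] [NormedSpace ℂ E]
    {f g : ℂ → E} (hf : Meromorphic f) (hg : Meromorphic g) {z : ℂ}
    (h : ∃ᶠ μ in 𝓝[≠] z, f μ = g μ) (a : ℂ) : f =ᶠ[𝓝[≠] a] g := by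
  have hfg : Meromorphic (f - g) := fun x => (hf x).sub (hg x)
  have h1 : meromorphicOrderAt (f - g) z = ⊤ := by
    rw [meromorphicOrderAt_eq_top_iff]
    rcases (hfg z).eventually_eq_zero_or_eventually_ne_zero with h2 | h2
    · exact h2
    · exact absurd h2 (by
        rw [not_eventually]
        exact h.mono fun μ hμ => by simp [hμ])
  have h2 : meromorphicOrderAt (f - g) a = ⊤ := by
    by_contra hc
    exact hfg.exists_meromorphicOrderAt_ne_top_iff_forall.1 ⟨a, hc⟩ z h1
  filter_upwards [meromorphicOrderAt_eq_top_iff.1 h2] with μ hμ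
  exact sub_eq_zero.1 hμ

theorem frequently_norm_eq_one : ∃ᶠ μ : ℂ in 𝓝[≠] 1, ‖μ‖ = 1 := by
  have h := (hasDerivAt_circleMap 0 1 0).tendsto_nhdsNE (by simp)
  rw [show circleMap 0 1 0 = 1 by simp [circleMap]] at h
  exact h.frequently (Eventually.frequently (Eventually.of_forall fun θ => by simp))

theorem eventually_one_lt_norm : ∀ᶠ μ : ℂ in 𝓝[≠] 2, 1 < ‖μ‖ := by
  refine eventually_nhdsWithin_of_eventually_nhds ?_
  exact continuous_norm.continuousAt.eventually_const_lt (by simp)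

theorem meromorphicOrderAt_polynomial {p : Polynomial ℂ} (hp : p ≠ 0) (a : ℂ) :
    meromorphicOrderAt (fun z => p.eval z) a = (p.rootMultiplicity a : ℤ) := by
  obtain ⟨q, hq, hdvd⟩ := p.exists_eq_pow_rootMultiplicity_mul_and_not_dvd hp a
  rw [meromorphicOrderAt_eq_int_iff (AnalyticOnNhd.eval_polynomial p a trivial).meromorphicAt]
  refine ⟨fun z => q.eval z, AnalyticOnNhd.eval_polynomial q a trivial, ?_, ?_⟩
  · intro h
    exact hdvd (Polynomial.dvd_iff_isRoot.2 h)
  · refine Eventually.of_forall fun z => ?_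
    conv_lhs => rw [hq]
    simp

/-- Jacobi's formula. If the determinant vanishes, both sides take the default value `0`. -/
theorem trace_matrixDeriv_mul_inv {S : ℂ → Matrix (Fin 2) (Fin 2) ℂ} {μ : ℂ}
    (hS : ∀ i j, DifferentiableAt ℂ (fun z => S z i j) μ) :
    (matrixDeriv S μ * (S μ)⁻¹).trace = logDeriv (fun z => (S z).det) μ := by
  have e : deriv (fun z => (S z).det) μ =
      deriv (fun z => S z 0 0) μ * S μ 1 1 + S μ 0 0 * deriv (fun z => S z 1 1) μ -
        (deriv (fun z => S z 0 1) μ * S μ 1 0 + S μ 0 1 * deriv (fun z => S z 1 0) μ) := by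
    simp only [Matrix.det_fin_two]
    exact (((hS 0 0).hasDerivAt.mul (hS 1 1).hasDerivAt).sub
      ((hS 0 1).hasDerivAt.mul (hS 1 0).hasDerivAt)).deriv
  rw [logDeriv_apply, e, Matrix.inv_def, Ring.inverse_eq_inv', Matrix.adjugate_fin_two,
    Matrix.trace_fin_two]
  simp [Matrix.mul_apply, matrixDeriv]
  ring

/-! ### The meromorphic continuation of the cut-off resolvent -/

/-- The continuation of the cut-off resolvent. -/
def siteResolvent (coin : Coin) (a : ℤ) (n : ℕ) (μ : ℂ) : Hilb →L[ℂ] Hilb :=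
  siteOperator a n (truncWalk coin a n - Matrix.scalar _ μ)⁻¹

theorem meromorphic_siteResolvent (coin : Coin) (a : ℤ) (n : ℕ) :
    Meromorphic (siteResolvent coin a n) := fun μ => by
  unfold siteResolvent siteOperator
  refine MeromorphicAt.fun_sum fun p _ => MeromorphicAt.fun_sum fun q _ => ?_
  exact (meromorphicAt_inv_apply _ p q μ).smul (MeromorphicAt.const _ _)

theorem analyticAt_siteResolvent {coin : Coin} {a : ℤ} {n : ℕ} {μ : ℂ}
    (hμ : (truncWalk coin a n - Matrix.scalar _ μ).det ≠ 0) :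
    AnalyticAt ℂ (siteResolvent coin a n) μ := by
  unfold siteResolvent siteOperator
  refine Finset.analyticAt_fun_sum _ fun p _ => Finset.analyticAt_fun_sum _ fun q _ => ?_
  exact (analyticAt_inv_apply _ p q hμ).smul analyticAt_const

theorem isExtendedResolvent_siteResolvent {coin : Coin} (h : Admissible coin) {J : Set ℝ} {a : ℤ}
    {n : ℕ} (hs : SupportedIn coin a n) (hJ : MeetsIn J a n) :
    IsExtendedResolvent coin J (siteResolvent coin a n) :=
  ⟨meromorphic_siteResolvent coin a n, fun _ hμ => (cutoffResolvent_eq h hs hJ hμ).symm⟩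

theorem IsExtendedResolvent.eventuallyEq {coin : Coin} (h : Admissible coin) {J : Set ℝ} {a : ℤ}
    {n : ℕ} (hs : SupportedIn coin a n) (hJ : MeetsIn J a n) {R : ℂ → (Hilb →L[ℂ] Hilb)}
    (hR : IsExtendedResolvent coin J R) (z : ℂ) : R =ᶠ[𝓝[≠] z] siteResolvent coin a n := by
  refine eventuallyEq_of_frequently_eq hR.1 (meromorphic_siteResolvent coin a n) (z := 2) ?_ z
  refine (eventually_one_lt_norm.mono fun μ hμ => ?_).frequently
  rw [hR.2 μ hμ, (isExtendedResolvent_siteResolvent h hs hJ).2 μ hμ]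

theorem extendSites_injective (a : ℤ) (n : ℕ) : Function.Injective (extendSites a n) :=
  Function.LeftInverse.injective (g := fun ψ : Hilb => restrictSites a n ψ)
    (restrictSites_extendSites a n)

/-- Restriction to the window is onto and extension by zero is injective, so neither changes the
rank. -/
theorem rank_siteOperator (a : ℤ) (n : ℕ) (A : Matrix (Fin n × Fin 2) (Fin n × Fin 2) ℂ) :
    (siteOperator a n A).toLinearMap.rank = Module.finrank ℂ (Matrix.toLin' A).range := by
  have e : (siteOperator a n A).toLinearMap.range =
      (Matrix.toLin' A).range.map (extendSites a n) := by
    ext φ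
    simp only [LinearMap.mem_range, Submodule.mem_map, exists_exists_eq_and,
      ContinuousLinearMap.coe_coe, siteOperator_apply, Matrix.toLin'_apply]
    constructor
    · rintro ⟨ψ, rfl⟩
      exact ⟨_, rfl⟩
    · rintro ⟨v, rfl⟩
      exact ⟨extendSites a n v, by rw [restrictSites_extendSites]⟩
  rw [LinearMap.rank, e, Module.finrank_eq_rank]
  exact ((Submodule.equivMapOfInjective _ (extendSites_injective a n) _).rank_eq).symm

theorem circleIntegral_siteResolvent {coin : Coin} {a : ℤ} {n : ℕ} {z : ℂ} {r : ℝ} (hr : 0 < r)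
    (h : ∀ μ ∈ Metric.closedBall z r, μ ≠ z →
      (truncWalk coin a n - Matrix.scalar _ μ).det ≠ 0) :
    circleIntegral (siteResolvent coin a n) z r =
      siteOperator a n (contourMatrix (truncWalk coin a n) z r) := by
  have hi : ∀ p q : Fin n × Fin 2, CircleIntegrable
      (fun μ => (truncWalk coin a n - Matrix.scalar (Fin n × Fin 2) μ)⁻¹ p q •
        (siteCoord a n q).smulRight (siteVec a n p)) z r := fun p q => by
    refine ContinuousOn.circleIntegrable hr.le fun μ hμ => ?_
    have hc := (analyticAt_inv_apply _ p q (h μ (Metric.sphere_subset_closedBall hμ)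
      (Metric.ne_of_mem_sphere hμ hr.ne'))).continuousAt.continuousWithinAt (s := Metric.sphere z r)
    exact hc.smul continuousWithinAt_const
  unfold siteResolvent siteOperator
  rw [circleIntegral.integral_fun_sum fun p _ => CircleIntegrable.fun_sum _ fun q _ => hi p q]
  refine Finset.sum_congr rfl fun p _ => ?_
  rw [circleIntegral.integral_fun_sum fun q _ => hi p q]
  refine Finset.sum_congr rfl fun q _ => ?_
  rw [circleIntegral.integral_smul_const]
  rfl

theorem hasMultiplicity_of_eventuallyEq {coin : Coin} {a : ℤ} {n : ℕ}
    {R : ℂ → (Hilb →L[ℂ] Hilb)} {z : ℂ} (hR : R =ᶠ[𝓝[≠] z] siteResolvent coin a n) :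
    HasMultiplicity R z ((truncWalk coin a n).charpoly.rootMultiplicity z) := by
  have := eventually_closedBall_of_eventually_nhdsNE
    (hR.and (eventually_det_sub_ne_zero (truncWalk coin a n) z))
  filter_upwards [this] with r hr
  obtain ⟨hr, h⟩ := hr
  rw [circleIntegral.integral_congr hr.le fun μ hμ => (h μ (Metric.sphere_subset_closedBall hμ)
    (Metric.ne_of_mem_sphere hμ hr.ne')).1,
    circleIntegral_siteResolvent hr fun μ hμ hne => (h μ hμ hne).2, rank_siteOperator,
    finrank_range_contourMatrix _ hr fun μ hμ hne => (h μ hμ hne).2]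

/-- Without a pole, `(μ - z) R(μ)` tends to `0`; on an eigenvector for `z` it is the constant `-1`.
-/
theorem isPole_iff_of_eventuallyEq {coin : Coin} {a : ℤ} {n : ℕ}
    {R : ℂ → (Hilb →L[ℂ] Hilb)} {z : ℂ} (hR : R =ᶠ[𝓝[≠] z] siteResolvent coin a n) :
    IsPole R z ↔ (truncWalk coin a n).charpoly.eval z = 0 := by
  rw [IsPole, meromorphicOrderAt_congr hR, eval_charpoly_eq_zero_iff]
  constructor
  · intro hlt
    by_contra hc
    exact absurd (analyticAt_siteResolvent hc).meromorphicOrderAt_nonneg (not_le.2 hlt)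
  · intro hdet
    by_contra hc
    obtain ⟨v, hv0, hv⟩ := Matrix.exists_mulVec_eq_zero_iff.2 hdet
    obtain ⟨c, hlim⟩ := (tendsto_nhds_iff_meromorphicOrderAt_nonneg
      (meromorphic_siteResolvent coin a n z)).2 (not_lt.1 hc)
    have h1 : Tendsto (fun μ => (μ - z) • siteResolvent coin a n μ (extendSites a n v))
        (𝓝[≠] z) (𝓝 ((z - z) • c (extendSites a n v))) := by
      refine Tendsto.smul ?_ ?_
      · exact ((continuous_id.sub continuous_const).tendsto z).mono_left nhdsWithin_le_nhds
      · exact ((ContinuousLinearMap.apply ℂ Hilb (extendSites a n v)).continuous.tendsto c).comp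
          hlim
    have h2 : Tendsto (fun μ => (μ - z) • siteResolvent coin a n μ (extendSites a n v))
        (𝓝[≠] z) (𝓝 (-extendSites a n v)) := by
      refine tendsto_const_nhds.congr' ?_
      filter_upwards [eventually_det_sub_ne_zero (truncWalk coin a n) z, self_mem_nhdsWithin]
        with μ hμ hne
      have hsub : μ - z ≠ 0 := sub_ne_zero.2 hne
      rw [siteResolvent, siteOperator_apply, restrictSites_extendSites,
        inv_mulVec_of_pow_mulVec_eq_zero _ hne hμ (k := 1) (by simpa using hv)]
      simp [smul_smul, hsub]
    have h3 := tendsto_nhds_unique h1 h2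
    rw [sub_self, zero_smul, eq_comm, neg_eq_zero] at h3
    exact hv0 (extendSites_injective a n (by rw [h3, map_zero]))

/-! ### The meromorphic continuation of the scattering matrix -/

theorem meromorphic_amp (coin : Coin) (a : ℤ) (n : ℕ) (i j : Fin 2) :
    Meromorphic fun μ => amp coin a μ n i j := fun z => by
  induction n generalizing i j with
  | zero => exact MeromorphicAt.const _ _
  | succ n ih =>
    simp only [amp, Matrix.mul_apply, Fin.sum_univ_two]
    refine (MeromorphicAt.mul ?_ (ih 0 j)).add (MeromorphicAt.mul ?_ (ih 1 j)) <;>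
      fin_cases i <;> simp [ampSite] <;> fun_prop

theorem analyticAt_amp (coin : Coin) (a : ℤ) (n : ℕ) (i j : Fin 2) {z : ℂ} (hz : z ≠ 0) :
    AnalyticAt ℂ (fun μ => amp coin a μ n i j) z := by
  have hp : ∀ k : ℤ, AnalyticAt ℂ (fun μ : ℂ => μ ^ k) z := fun k => analyticAt_id.zpow hz
  induction n generalizing i j with
  | zero => exact analyticAt_const
  | succ n ih =>
    simp only [amp, Matrix.mul_apply, Fin.sum_univ_two]
    refine (AnalyticAt.mul ?_ (ih 0 j)).add (AnalyticAt.mul ?_ (ih 1 j))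
    · fin_cases i
      · simpa [ampSite] using analyticAt_const
      · simp only [ampSite, Fin.mk_one, Matrix.smul_apply, smul_eq_mul]
        exact analyticAt_const.mul (analyticAt_const.mul (hp _))
    · fin_cases i
      · simp only [ampSite, Fin.zero_eta, Matrix.smul_apply, smul_eq_mul]
        exact analyticAt_const.mul (analyticAt_const.mul (hp _))
      · simpa [ampSite] using analyticAt_const

theorem meromorphic_scat (coin : Coin) (a : ℤ) (n : ℕ) (i j : Fin 2) :
    Meromorphic fun μ => scat coin a n μ i j := fun z => by
  have h := fun i j => meromorphic_amp coin a n i j z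
  have h00 := h 0 0
  have h01 := h 0 1
  have h10 := h 1 0
  have h11 := h 1 1
  fin_cases i <;> fin_cases j <;> simp [scat, Matrix.det_fin_two] <;> fun_prop

theorem differentiableAt_scat (coin : Coin) (a : ℤ) (n : ℕ) (i j : Fin 2) {z : ℂ} (hz : z ≠ 0)
    (hM : amp coin a z n 0 0 ≠ 0) : DifferentiableAt ℂ (fun μ => scat coin a n μ i j) z := by
  have h := fun i j => (analyticAt_amp coin a n i j hz).differentiableAt
  have h00 := h 0 0
  have h01 := h 0 1
  have h10 := h 1 0
  have h11 := h 1 1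
  fin_cases i <;> fin_cases j <;> simp [scat, Matrix.det_fin_two] <;> fun_prop (disch := assumption)

theorem isExtendedScatteringMatrix_scat {coin : Coin} (h : Admissible coin) {a : ℤ} {n : ℕ}
    (hs : SupportedIn coin a n) : IsExtendedScatteringMatrix coin (scat coin a n) :=
  ⟨meromorphic_scat coin a n, fun _ hμ => (isScatteringMatrixAt_iff h hs hμ _).2 rfl⟩

theorem IsExtendedScatteringMatrix.eventuallyEq {coin : Coin} (h : Admissible coin) {a : ℤ} {n : ℕ}
    (hs : SupportedIn coin a n) {S : ℂ → Matrix (Fin 2) (Fin 2) ℂ}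
    (hS : IsExtendedScatteringMatrix coin S) (z : ℂ) (i j : Fin 2) :
    (fun μ => S μ i j) =ᶠ[𝓝[≠] z] fun μ => scat coin a n μ i j := by
  refine eventuallyEq_of_frequently_eq (hS.1 i j) (meromorphic_scat coin a n i j) (z := 1) ?_ z
  refine frequently_norm_eq_one.mono fun μ hμ => ?_
  rw [(isScatteringMatrixAt_iff h hs hμ _).1 (hS.2 μ hμ)]

theorem det_scat {coin : Coin} {a : ℤ} {n : ℕ} {μ : ℂ} (hM : amp coin a μ n 0 0 ≠ 0) :
    (scat coin a n μ).det = amp coin a μ n 1 1 / amp coin a μ n 0 0 := by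
  rw [scat, Matrix.det_fin_two_of, Matrix.det_fin_two]
  field_simp
  ring

/-! ### Poles of the trace and the logarithmic derivative of the determinant -/

theorem prod_diag_ne_zero {coin : Coin} (h : Admissible coin) (a : ℤ) (n : ℕ) :
    ∏ k ∈ Finset.range n, (coin (a + k) : Matrix (Fin 2) (Fin 2) ℂ) 0 0 ≠ 0 :=
  Finset.prod_ne_zero_iff.2 fun _ _ => h.diag_ne_zero _ 0

/-- The trace is `(1 + Δ) / M₀₀`, and `M₀₀` is the characteristic polynomial up to `κ μ^(2n)`. The
condition on `Δ` keeps the numerator non-zero. -/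
theorem exists_trace_scat_eq {coin : Coin} (h : Admissible coin) {a : ℤ} {n : ℕ}
    (hs : SupportedIn coin a n) (hΔ : transferDet coin ≠ -1) :
    ∃ c : ℂ, c ≠ 0 ∧ ∀ μ ≠ 0, (scat coin a n μ).trace =
      (Polynomial.C c * Polynomial.X ^ (2 * n)).eval μ *
        ((truncWalk coin a n).charpoly.eval μ)⁻¹ := by
  have hκ := prod_diag_ne_zero h a n
  refine ⟨(1 + transferDet coin) * ∏ k ∈ Finset.range n,
    (coin (a + k) : Matrix (Fin 2) (Fin 2) ℂ) 0 0, mul_ne_zero (fun hc => hΔ ?_) hκ, fun μ hμ => ?_⟩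
  · linear_combination hc
  · have hpow : μ ^ (2 * n) ≠ 0 := pow_ne_zero _ hμ
    rw [eval_charpoly_truncWalk h a n hμ, Matrix.trace_fin_two]
    simp only [scat, Matrix.of_apply, Matrix.cons_val', Matrix.cons_val_zero, Matrix.cons_val_one,
      Matrix.cons_val_fin_one, det_amp_eq_transferDet h hs hμ, Polynomial.eval_mul,
      Polynomial.eval_C, Polynomial.eval_pow, Polynomial.eval_X]
    rw [mul_inv, mul_inv]
    generalize (amp coin a μ n 0 0) = w
    rw [div_eq_mul_inv]
    -- Treating the inverse as a free variable keeps the identity valid where `M₀₀ = 0`.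
    generalize w⁻¹ = w'
    field_simp

theorem meromorphicOrderAt_trace_scat {coin : Coin} (h : Admissible coin) {a : ℤ} {n : ℕ}
    (hs : SupportedIn coin a n) (hΔ : transferDet coin ≠ -1) {z : ℂ} (hz : z ≠ 0) :
    meromorphicOrderAt (fun μ => (scat coin a n μ).trace) z =
      ((-((truncWalk coin a n).charpoly.rootMultiplicity z : ℕ) : ℤ) : WithTop ℤ) := by
  obtain ⟨c, hc, htr⟩ := exists_trace_scat_eq h hs hΔ
  have hp : (truncWalk coin a n).charpoly ≠ 0 := (Matrix.charpoly_monic _).ne_zero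
  have hf : Polynomial.C c * Polynomial.X ^ (2 * n) ≠ 0 := by simp [hc]
  have e : (fun μ => (scat coin a n μ).trace) =ᶠ[𝓝[≠] z]
      fun μ => (Polynomial.C c * Polynomial.X ^ (2 * n)).eval μ *
        ((truncWalk coin a n).charpoly.eval μ)⁻¹ := by
    filter_upwards [eventually_nhdsWithin_of_eventually_nhds (isOpen_ne.mem_nhds hz)] with μ hμ
    exact htr μ hμ
  rw [meromorphicOrderAt_congr e, fun_meromorphicOrderAt_mul
    (AnalyticOnNhd.eval_polynomial _ z trivial).meromorphicAt
    (AnalyticOnNhd.eval_polynomial _ z trivial).meromorphicAt.fun_inv,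
    meromorphicOrderAt_polynomial hf, fun_meromorphicOrderAt_inv,
    meromorphicOrderAt_polynomial hp, Polynomial.rootMultiplicity_eq_zero]
  · simp
  · simp [hc, hz]

/-- The numerator vanishes to order at least `2n` at `0`, and the denominator has degree `2n`. -/
theorem meromorphicOrderAt_trace_scat_zero {coin : Coin} (h : Admissible coin) {a : ℤ} {n : ℕ}
    (hs : SupportedIn coin a n) (hΔ : transferDet coin ≠ -1) :
    0 ≤ meromorphicOrderAt (fun μ => (scat coin a n μ).trace) 0 := by
  obtain ⟨c, hc, htr⟩ := exists_trace_scat_eq h hs hΔ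
  have hp : (truncWalk coin a n).charpoly ≠ 0 := (Matrix.charpoly_monic _).ne_zero
  have hf : Polynomial.C c * Polynomial.X ^ (2 * n) ≠ 0 := by simp [hc]
  have e : (fun μ => (scat coin a n μ).trace) =ᶠ[𝓝[≠] 0]
      fun μ => (Polynomial.C c * Polynomial.X ^ (2 * n)).eval μ *
        ((truncWalk coin a n).charpoly.eval μ)⁻¹ := by
    filter_upwards [self_mem_nhdsWithin] with μ hμ
    exact htr μ hμ
  have h1 : 2 * n ≤ (Polynomial.C c * Polynomial.X ^ (2 * n)).rootMultiplicity 0 := by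
    rw [Polynomial.le_rootMultiplicity_iff hf]
    simp
  have h2 : (truncWalk coin a n).charpoly.rootMultiplicity 0 ≤ 2 * n := by
    rw [← Polynomial.count_roots]
    refine ((Multiset.count_le_card _ _).trans (Polynomial.card_roots' _)).trans ?_
    rw [Matrix.charpoly_natDegree_eq_dim]
    simp [mul_comm]
  rw [meromorphicOrderAt_congr e, fun_meromorphicOrderAt_mul
    (AnalyticOnNhd.eval_polynomial _ 0 trivial).meromorphicAt
    (AnalyticOnNhd.eval_polynomial _ 0 trivial).meromorphicAt.fun_inv,
    meromorphicOrderAt_polynomial hf, fun_meromorphicOrderAt_inv,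
    meromorphicOrderAt_polynomial hp, ← WithTop.LinearOrderedAddCommGroup.coe_neg,
    ← WithTop.coe_add]
  exact_mod_cast (by omega : (0 : ℤ) ≤
    ((Polynomial.C c * Polynomial.X ^ (2 * n)).rootMultiplicity 0 : ℤ) +
      -((truncWalk coin a n).charpoly.rootMultiplicity 0 : ℤ))

/-- Near a non-zero point of the closed unit disc, the determinant of the scattering matrix is
the power given by the characteristic polynomial times a non-vanishing analytic function. -/
theorem exists_det_scat_eq {coin : Coin} (h : Admissible coin) {a : ℤ} {n : ℕ}
    (hs : SupportedIn coin a n) {z : ℂ} (hz : z ≠ 0) (hz1 : ‖z‖ ≤ 1) :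
    ∃ g : ℂ → ℂ, AnalyticAt ℂ g z ∧ g z ≠ 0 ∧
      (fun μ => (scat coin a n μ).det) =ᶠ[𝓝[≠] z] fun μ =>
        (μ - z) ^ (-((truncWalk coin a n).charpoly.rootMultiplicity z : ℕ) : ℤ) * g μ := by
  have hp : (truncWalk coin a n).charpoly ≠ 0 := (Matrix.charpoly_monic _).ne_zero
  obtain ⟨q, hq, hdvd⟩ :=
    (truncWalk coin a n).charpoly.exists_eq_pow_rootMultiplicity_mul_and_not_dvd hp z
  set m := (truncWalk coin a n).charpoly.rootMultiplicity z
  have hκ := prod_diag_ne_zero h a n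
  set κ := ∏ k ∈ Finset.range n, (coin (a + k) : Matrix (Fin 2) (Fin 2) ℂ) 0 0
  have hqz : q.eval z ≠ 0 := fun hc => hdvd (Polynomial.dvd_iff_isRoot.2 hc)
  -- This is `M₁₁ / M₀₀` with `M₀₀ = χ / (κ μ^(2n))`, after the factor `(μ - z) ^ m` is taken out of
  -- `χ`.
  refine ⟨fun μ => amp coin a μ n 1 1 * (κ * μ ^ (2 * n)) / q.eval μ, ?_, ?_, ?_⟩
  · exact ((analyticAt_amp coin a n 1 1 hz).mul
      (analyticAt_const.mul (analyticAt_id.pow _))).div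
      (AnalyticOnNhd.eval_polynomial q z trivial) hqz
  · exact div_ne_zero (mul_ne_zero (amp_one_one_ne_zero h hs hz hz1)
      (mul_ne_zero hκ (pow_ne_zero _ hz))) hqz
  · filter_upwards [eventually_nhdsWithin_of_eventually_nhds (isOpen_ne.mem_nhds hz),
      eventually_det_sub_ne_zero (truncWalk coin a n) z, self_mem_nhdsWithin] with μ hμ hdet hne
    have hsub : μ - z ≠ 0 := sub_ne_zero.2 hne
    have h1 : (truncWalk coin a n).charpoly.eval μ ≠ 0 :=
      fun hc => hdet ((eval_charpoly_eq_zero_iff _ _).1 hc)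
    have h2 := eval_charpoly_truncWalk h a n hμ
    have hM : amp coin a μ n 0 0 ≠ 0 := fun hc => h1 (by rw [h2, hc, mul_zero])
    have h3 : (truncWalk coin a n).charpoly.eval μ = (μ - z) ^ m * q.eval μ := by
      conv_lhs => rw [hq]
      simp
    have hqμ : q.eval μ ≠ 0 := fun hc => h1 (by rw [h3, hc, mul_zero])
    have h4 : (μ - z) ^ m * q.eval μ = κ * μ ^ (2 * n) * amp coin a μ n 0 0 := h3.symm.trans h2
    rw [det_scat hM, zpow_neg, zpow_natCast]
    have hm : (μ - z) ^ m ≠ 0 := pow_ne_zero _ hsub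
    field_simp
    linear_combination amp coin a μ n 1 1 * h4

/-- Near `z` the integrand is `-m / (μ - z) + g' / g` with `g` analytic and non-zero, so only the
first term contributes. -/
theorem circleIntegral_trace_matrixDeriv {coin : Coin} (h : Admissible coin) {a : ℤ} {n : ℕ}
    (hs : SupportedIn coin a n) {S : ℂ → Matrix (Fin 2) (Fin 2) ℂ} {z : ℂ}
    (hS : ∀ i j, (fun μ => S μ i j) =ᶠ[𝓝[≠] z] fun μ => scat coin a n μ i j)
    (hz : z ≠ 0) (hz1 : ‖z‖ ≤ 1) :
    ∀ᶠ r : ℝ in 𝓝[>] 0, circleIntegral (fun μ => (matrixDeriv S μ * (S μ)⁻¹).trace) z r =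
      -((truncWalk coin a n).charpoly.rootMultiplicity z : ℂ) * (2 * Real.pi * Complex.I) := by
  obtain ⟨g, hg, hgz, hdet⟩ := exists_det_scat_eq h hs hz hz1
  set m := (truncWalk coin a n).charpoly.rootMultiplicity z
  have hreg : ∀ᶠ μ in 𝓝 z, AnalyticAt ℂ g μ ∧ g μ ≠ 0 :=
    hg.eventually_analyticAt.and (hg.continuousAt.eventually_ne hgz)
  have hSall : ∀ᶠ μ in 𝓝[≠] z, ∀ i j, S μ i j = scat coin a n μ i j :=
    eventually_all.2 fun i => eventually_all.2 fun j => hS i j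
  -- Points of a punctured neighbourhood are interior to it, so the derivatives agree there as well.
  have hDall : ∀ᶠ μ in 𝓝[≠] z, ∀ i j, deriv (fun w => S w i j) μ =
      deriv (fun w => scat coin a n w i j) μ :=
    eventually_all.2 fun i => eventually_all.2 fun j => (hS i j).nhdsNE_deriv
  have key : ∀ᶠ μ in 𝓝[≠] z, (matrixDeriv S μ * (S μ)⁻¹).trace =
      -(m : ℂ) * (μ - z)⁻¹ + logDeriv g μ := by
    filter_upwards [hSall, hDall, hdet, hdet.nhdsNE_deriv,
      eventually_nhdsWithin_of_eventually_nhds hreg,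
      eventually_nhdsWithin_of_eventually_nhds (isOpen_ne.mem_nhds hz),
      eventually_det_sub_ne_zero (truncWalk coin a n) z, self_mem_nhdsWithin]
      with μ h1 h2 h3 h4 h5 hμ h6 hne
    have hsub : μ - z ≠ 0 := sub_ne_zero.2 hne
    have hM : amp coin a μ n 0 0 ≠ 0 := fun hc =>
      h6 (by rw [det_truncWalk_sub h a n hμ, hc, mul_zero])
    have e1 : S μ = scat coin a n μ := by ext i j; exact h1 i j
    have e2 : matrixDeriv S μ = matrixDeriv (scat coin a n) μ := by ext i j; exact h2 i j
    have hd : DifferentiableAt ℂ (fun w => w - z) μ := by fun_prop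
    rw [e1, e2, trace_matrixDeriv_mul_inv fun i j => differentiableAt_scat coin a n i j hμ hM,
      logDeriv_apply, h4, h3, ← logDeriv_apply (fun w => (w - z) ^ (-(m : ℕ) : ℤ) * g w),
      logDeriv_mul (f := fun w => (w - z) ^ (-(m : ℕ) : ℤ)) (g := g) μ (zpow_ne_zero _ hsub) h5.2 (hd.zpow (Or.inl hsub)) h5.1.differentiableAt,
      logDeriv_fun_zpow hd]
    congr 1
    simp [logDeriv_apply]
  filter_upwards [eventually_closedBall_of_eventually_nhdsNE
    (key.and (eventually_nhdsWithin_of_eventually_nhds hreg))] with r hr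
  obtain ⟨hr, hr'⟩ := hr
  have hball : ∀ μ ∈ Metric.closedBall z r, AnalyticAt ℂ g μ ∧ g μ ≠ 0 := fun μ hμ => by
    by_cases hne : μ = z
    · rw [hne]; exact hreg.self_of_nhds
    · exact (hr' μ hμ hne).2
  have hlog : ∀ μ ∈ Metric.closedBall z r, AnalyticAt ℂ (logDeriv g) μ := fun μ hμ =>
    (hball μ hμ).1.deriv.div (hball μ hμ).1 (hball μ hμ).2
  rw [circleIntegral.integral_congr hr.le fun μ hμ => (hr' μ (Metric.sphere_subset_closedBall hμ)
    (Metric.ne_of_mem_sphere hμ hr.ne')).1, circleIntegral.integral_add,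
    circleIntegral.integral_const_mul, circleIntegral.integral_sub_center_inv z hr.ne',
    DiffContOnCl.circleIntegral_eq_zero hr.le, add_zero]
  · refine DifferentiableOn.diffContOnCl fun μ hμ => ?_
    rw [closure_ball _ hr.ne'] at hμ
    exact (hlog μ hμ).differentiableAt.differentiableWithinAt
  · refine ContinuousOn.circleIntegrable hr.le fun μ hμ => ?_
    have hne : μ - z ≠ 0 := sub_ne_zero.2 (Metric.ne_of_mem_sphere hμ hr.ne')
    exact ContinuousAt.continuousWithinAt (by fun_prop (disch := assumption))
  · refine ContinuousOn.circleIntegrable hr.le fun μ hμ => ?_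
    exact (hlog μ (Metric.sphere_subset_closedBall hμ)).continuousAt.continuousWithinAt

theorem exists_supportedIn {coin : Coin} (h : Admissible coin) :
    ∃ a n, SupportedIn coin a n := by
  refine ⟨firstSite coin, (lastSite coin - firstSite coin + 1).toNat, fun x hx => ?_⟩
  by_contra hc
  have h1 : firstSite coin ≤ x := csInf_le h.finite_support.bddBelow hc
  have h2 : x ≤ lastSite coin := le_csSup h.finite_support.bddAbove hc
  omega

end

end QuantumWalk

/-! ### The claim on resonances and scattering poles -/

open QuantumWalk in
theorem mainTheorem10 (coin : Coin) (hcoin : Admissible coin) :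
    (∃ S, IsExtendedScatteringMatrix coin S) ∧
    (∀ J, IsWindow coin J → ∃ R, IsExtendedResolvent coin J R) ∧
    ((∀ x, (coin x : Matrix (Fin 2) (Fin 2) ℂ) 0 0 = (coin x : Matrix (Fin 2) (Fin 2) ℂ) 1 1) →
      transferDet coin ≠ -1) ∧
    (transferDet coin ≠ -1 →
      ∀ S, IsExtendedScatteringMatrix coin S →
      ∀ J, IsWindow coin J → ∀ R, IsExtendedResolvent coin J R →
        (∀ a : ℂ, (a ≠ 0 ∧ IsPole R a) ↔ IsPole (fun μ => (S μ).trace) a) ∧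
        ∀ a : ℂ, a ≠ 0 → IsPole R a → ∃ m : ℕ, HasMultiplicity R a m ∧
          meromorphicOrderAt (fun μ => (S μ).trace) a = ((-m : ℤ) : WithTop ℤ) ∧
          ∀ᶠ r : ℝ in 𝓝[>] 0, (m : ℂ) = -((2 * Real.pi * Complex.I)⁻¹ *
            circleIntegral (fun μ => (matrixDeriv S μ * (S μ)⁻¹).trace) a r)) := by
  refine ⟨?_, fun J hJ => ?_, fun hd => ?_, fun hΔ S hS J hJ R hR => ?_⟩
  · obtain ⟨a, n, hs⟩ := exists_supportedIn hcoin
    exact ⟨_, isExtendedScatteringMatrix_scat hcoin hs⟩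
  · obtain ⟨a, n, hm⟩ := exists_meetsIn hJ.1 hJ.2.1
    exact ⟨_, isExtendedResolvent_siteResolvent hcoin (hJ.supportedIn hm) hm⟩
  · rw [transferDet_eq_one hcoin hd]
    norm_num
  · obtain ⟨x, n, hm⟩ := exists_meetsIn hJ.1 hJ.2.1
    have hs := hJ.supportedIn hm
    have hRe := hR.eventuallyEq hcoin hs hm
    have hSe := fun z i j => hS.eventuallyEq hcoin hs z i j
    have htr : ∀ z, (fun μ => (S μ).trace) =ᶠ[𝓝[≠] z] fun μ => (scat coin x n μ).trace :=
      fun z => by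
        filter_upwards [hSe z 0 0, hSe z 1 1] with μ h1 h2
        rw [Matrix.trace_fin_two, Matrix.trace_fin_two, h1, h2]
    have hp : (truncWalk coin x n).charpoly ≠ 0 := (Matrix.charpoly_monic _).ne_zero
    refine ⟨fun z => ?_, fun z hz hpole => ⟨_, hasMultiplicity_of_eventuallyEq (hRe z), ?_, ?_⟩⟩
    · by_cases hz : z = 0
      · subst hz
        have := meromorphicOrderAt_trace_scat_zero hcoin hs hΔ
        rw [← meromorphicOrderAt_congr (htr 0)] at this
        simp [IsPole, this]
      · rw [isPole_iff_of_eventuallyEq (hRe z), IsPole, meromorphicOrderAt_congr (htr z),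
          meromorphicOrderAt_trace_scat hcoin hs hΔ hz, ← WithTop.coe_zero, WithTop.coe_lt_coe,
          neg_lt_zero, Nat.cast_pos, Polynomial.rootMultiplicity_pos hp, Polynomial.IsRoot]
        simp [hz]
    · rw [meromorphicOrderAt_congr (htr z), meromorphicOrderAt_trace_scat hcoin hs hΔ hz]
    · have hroot := (isPole_iff_of_eventuallyEq (hRe z)).1 hpole
      -- Needed for `M₁₁(z) ≠ 0`, so that `det S` has a pole of the full order `m`.
      have hz1 : ‖z‖ ≤ 1 := by
        by_contra! hlt
        exact det_truncWalk_sub_ne_zero hcoin hs hlt.le ((eval_charpoly_eq_zero_iff _ _).1 hroot)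
      filter_upwards [circleIntegral_trace_matrixDeriv hcoin hs (hSe z) hz hz1] with r hr
      rw [hr]
      field_simp [Complex.two_pi_I_ne_zero]
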